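/- Let $I=\mathbb R_+$ or $I=\mathbb Z_+$, and let $(X_t)_{t\in I}$ be a time-homogeneous Markov process on a topological state space $E$ (with a $\sigma$-algebra containing the Borel sets), jointly measurable in $(t,\omega)$, with laws $(\mathbb P_x)_{x\in E}$, $\mathbb P_x(X_0=x)=1$, path shifts and natural filtration $\mathcal F_t=\sigma(X_r,\ r\le t)$. For a probability measure $\mu$ put $\mathbb P_\mu=\int\mathbb P_x\,\mu(dx)$. Let $(A_t)_{t\in I}$ be measurable subsets of $E$, $E_t=E\setminus A_t$, $\mathcal M_1(F)$ the set of probability measures carried by $F$, and $$\tau_{A\circ\theta_s}=\inf\{t\in I: X_t\in A_{s+t}\},\qquad \tau_A=\tau_{A\circ\theta_0},\qquad A_\infty=\bigcap_{t\in I}A_t,\quad E_\infty=E\setminus A_\infty,\quad \tau_{A_\infty}=\inf\{t\in I:X_t\in A_\infty\}.$$ The times $\tau_{A\circ\theta_s}$ and $\tau_{A_\infty}$ are assumed to be $(\mathcal F_t)$-stopping times. Assume: (H0) for all $s,t\in I$ and $x\in E_s$: $\mathbb P_x(\tau_{A\circ\theta_s}<\infty)=1$ and $\mathbb P_x(\tau_{A\circ\theta_s}>t)>0$;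 (H1) $A_t\subset A_s$ for $s\le t$, and $A_\infty\neq\emptyset$; (H2) there are $\nu_s\in\mathcal M_1(E_s)$ ($s\in I$), $t_0\in I$ with $t_0>0$, and $c_1,c_2>0$ such that for all $s,t\in I$, $x\in E_s$: $\mathbb P_x(X_{t_0}\in\cdot\mid\tau_{A\circ\theta_s}>t_0)\ge c_1\nu_{s+t_0}$ and $\mathbb P_{\nu_s}(\tau_{A\circ\theta_s}>t)\ge c_2\,\mathbb P_x(\tau_{A\circ\theta_s}>t)$; (H3) there are $\nu_\infty\in\mathcal M_1(E_\infty)$, $t_\infty\in I$ and $c_{1,\infty},c_{2,\infty}>0$ such that for all $x\in E_\infty$, $t\in I$: $\mathbb P_x(X_{t_\infty}\in\cdot\mid\tau_{A_\infty}>t_\infty)\ge c_{1,\infty}\nu_\infty$ and $\mathbb P_{\nu_\infty}(\tau_{A_\infty}>t)\ge c_{2,\infty}\,\mathbb P_x(\tau_{A_\infty}>t)$; (H4) $X$ has the strong Markov property at $(\mathcal F_t)$-stopping times; for every $x\in E_0$, $\tau_{A\circ\theta_s}\to\tau_{A_\infty}$ in law under $\mathbb P_x$ as $s\to\infty$; for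 every $x\in E_0$ and $s\in I$ the functions $t\mapsto\mathbb P_x(\tau_{A\circ\theta_s}>t)$ and $t\mapsto\mathbb P_x(\tau_{A_\infty}>t)$ are continuous; and for every $t>0$ the function $x\mapsto\mathbb P_x(\tau_{A_\infty}>t)$ is continuous on $E$. Then the following hold. (a) The $Q$-process of $X$ absorbed by the fixed set $A_\infty$ exists: for all $x\in E_\infty$, $t\in I$ there is a law $\mathbb Q^\infty_x(X_{[0,t]}\in\cdot)$ on trajectories over $[0,t]$ such that $\mathbb P_x(X_{[0,t]}\in B\mid\tau_{A_\infty}>t+T)\to\mathbb Q^\infty_x(X_{[0,t]}\in B)$ as $T\to\infty$ for every measurable set $B$ of trajectories. It has exactly one invariant probability measure $\beta_\infty\in\mathcal M_1(E_\infty)$, that is, $\int\mathbb Q^\infty_x(X_t\in\cdot)\,\beta_\infty(dx)=\beta_\infty$ for all $t\in I$. (b) For every $x\in E_0$, weakly (against bounded continuous functions), $$\frac1t\int_0^t\mathbb P_x(X_s\in\cdot\mid\tau_A>t)\,ds\ \longrightarrow\ \beta_\infty\quad(t\to\infty)\qquad\text{if } I=\mathbb R_+,$$ $$\frac1n\sum_{k=0}^n\mathbb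 P_x(X_k\in\cdot\mid\tau_A>n)\ \longrightarrow\ \beta_\infty\quad(n\to\infty)\qquad\text{if } I=\mathbb Z_+.$$ (c) The $Q$-process for the moving boundary exists: for all $s,t\in I$, $x\in E_s$ there is a law $\mathbb Q_{s,x}(X_{[s,s+t]}\in\cdot)$ with $\mathbb P_x(X_{[0,t]}\in B\mid\tau_{A\circ\theta_s}>t+T)\to\mathbb Q_{s,x}(X_{[s,s+t]}\in B)$ as $T\to\infty$ for every measurable $B$. For every $s\in I$ and $\mu\in\mathcal M_1(E_s)$, with $\mathbb Q_{s,\mu}=\int\mathbb Q_{s,x}\,\mu(dx)$, the laws $\mathbb Q_{s,\mu}(X_{t}\in\cdot)$ converge weakly to $\beta_\infty$ as $t\to\infty$. -/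

import Mathlib

open MeasureTheory ProbabilityTheory Filter Topology
open scoped NNReal ENNReal BoundedContinuousFunction

namespace MovingBoundary

/-! ### Markov families -/

/-- The natural filtration `F_t = σ(X_r, r ≤ t)` of a process. -/
def naturalFiltration {I E Ω : Type*} [Preorder I] [mE : MeasurableSpace E]
    [mΩ : MeasurableSpace Ω] (X : I → Ω → E) (hX : ∀ t, Measurable (X t)) : Filtration I mΩ where
  seq t := ⨆ r ≤ t, MeasurableSpace.comap (X r) mE
  mono' _ _ hst := biSup_mono fun _ hr => hr.trans hst
  le' _ := iSup₂_le fun r _ => (hX r).comap_le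

/-- A time-homogeneous (measurable) Markov process `(X_t)` with time set `I`, state space `E`,
sample space `Ω`, path shifts `X_r ∘ shift_t = X_{t+r}`, and laws `(P_x)_{x ∈ E}`. The simple Markov
property is with respect to the natural filtration: for every `t`, every `F ∈ F_t` and every
`Λ ∈ σ(X_r, r ∈ I)`, `P_x(F ∩ {shift_t ∈ Λ}) = E_x[1_F P_{X_t}(Λ)]`. -/
structure MarkovFamily (I E Ω : Type*) [AddCommMonoid I] [Preorder I] [MeasurableSpace I]
    [MeasurableSpace E] [MeasurableSpace Ω] where
  X : I → Ω → E
  shift : I → Ω → Ω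
  P : Kernel E Ω
  isMarkovKernel : IsMarkovKernel P
  measurable_X : ∀ t, Measurable (X t)
  measurable_uncurry_X : Measurable (Function.uncurry X)
  X_shift : ∀ t r ω, X r (shift t ω) = X (t + r) ω
  start : ∀ x, ∀ᵐ ω ∂(P x), X 0 ω = x
  markov : ∀ (x : E) (t : I) (F Λ : Set Ω),
    MeasurableSet[naturalFiltration X measurable_X t] F →
    MeasurableSet[⨆ r, naturalFiltration X measurable_X r] Λ →
    P x (F ∩ shift t ⁻¹' Λ) = ∫⁻ ω in F, P (X t ω) Λ ∂(P x)

section Generic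

variable {I E Ω : Type*} [AddCommMonoid I] [ConditionallyCompleteLinearOrderBot I]
  [MeasurableSpace I] [MeasurableSpace E] [MeasurableSpace Ω]

/-- The natural filtration of the Markov family. -/
def MarkovFamily.filtration (M : MarkovFamily I E Ω) : Filtration I ‹MeasurableSpace Ω› :=
  naturalFiltration M.X M.measurable_X

/-- The strong Markov property at stopping times of the natural filtration:
`P_x(shift_τ ∈ Λ, τ < ∞ | F_τ) = 1_{τ < ∞} P_{X_τ}(Λ)`, in integrated form over `F ∈ F_τ`. -/
def MarkovFamily.StrongMarkov (M : MarkovFamily I E Ω) : Prop :=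
  ∀ (τ : Ω → WithTop I) (hτ : IsStoppingTime M.filtration τ) (x : E) (F Λ : Set Ω),
    MeasurableSet[hτ.measurableSpace] F →
    MeasurableSet[⨆ r, M.filtration r] Λ →
    M.P x (F ∩ {ω | ∃ t : I, τ ω = t ∧ M.shift t ω ∈ Λ}) =
      ∫⁻ ω in F ∩ {ω | τ ω < ⊤}, M.P (M.X ((τ ω).untopD 0) ω) Λ ∂(M.P x)

/-! ### Moving boundaries and hitting times -/

/-- The time-shifted boundary `A ∘ θ_s : t ↦ A_{s+t}`. -/
def shiftBoundary (A : I → Set E) (s : I) : I → Set E := fun t => A (s + t)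

/-- `A_∞ = ⋂_t A_t`. -/
def limitBoundary (A : I → Set E) : Set E := ⋂ t, A t

/-- `τ_A = inf {t : X_t ∈ A_t}`, equal to `⊤` when there is no such `t`. -/
noncomputable def MarkovFamily.hit (M : MarkovFamily I E Ω) (A : I → Set E) (ω : Ω) : WithTop I :=
  sInf ((fun t : I => (t : WithTop I)) '' {t | M.X t ω ∈ A t})

/-- The survival event `{τ_A > t}`. -/
def MarkovFamily.survive (M : MarkovFamily I E Ω) (A : I → Set E) (t : I) : Set Ω :=
  {ω | (t : WithTop I) < M.hit A ω}

/-- `P_x(· | τ_A > u)`, a measure on the sample space. -/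
noncomputable def MarkovFamily.condP (M : MarkovFamily I E Ω) (A : I → Set E) (x : E) (u : I) :
    Measure Ω :=
  ProbabilityTheory.cond (M.P x) (M.survive A u)

/-- `P_x(X_t ∈ · | τ_A > u)`, a measure on the state space. -/
noncomputable def MarkovFamily.condLaw (M : MarkovFamily I E Ω) (A : I → Set E) (x : E) (t u : I) :
    Measure E :=
  (M.condP A x u).map (M.X t)

/-- `μ` is a probability measure carried by `S`, i.e. `μ ∈ M_1(S)`. -/
def IsLawOn (μ : Measure E) (S : Set E) : Prop :=
  IsProbabilityMeasure μ ∧ μ Sᶜ = 0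

/-- The Champagnat–Villemonais type conditions for the moving boundary `A`. -/
def MovingCV (M : MarkovFamily I E Ω) (A : I → Set E) : Prop :=
  ∃ (ν : I → Measure E) (t₀ : I) (c₁ c₂ : ℝ≥0), 0 < t₀ ∧ 0 < c₁ ∧ 0 < c₂ ∧
    (∀ s, IsLawOn (ν s) (A s)ᶜ) ∧
    (∀ s, ∀ x ∈ (A s)ᶜ, c₁ • ν (s + t₀) ≤ M.condLaw (shiftBoundary A s) x t₀ t₀) ∧
    (∀ s t, ∀ x ∈ (A s)ᶜ,
      (c₂ : ℝ≥0∞) * M.P x (M.survive (shiftBoundary A s) t) ≤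
        ∫⁻ y, M.P y (M.survive (shiftBoundary A s) t) ∂(ν s))

/-- The Champagnat–Villemonais conditions for a fixed absorbing set `D`. -/
def FixedCV (M : MarkovFamily I E Ω) (D : Set E) : Prop :=
  ∃ (ν : Measure E) (t₀ : I) (c₁ c₂ : ℝ≥0), 0 < c₁ ∧ 0 < c₂ ∧ IsLawOn ν Dᶜ ∧
    (∀ x ∈ Dᶜ, c₁ • ν ≤ M.condLaw (fun _ => D) x t₀ t₀) ∧
    (∀ t, ∀ x ∈ Dᶜ,
      (c₂ : ℝ≥0∞) * M.P x (M.survive (fun _ => D) t) ≤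
        ∫⁻ y, M.P y (M.survive (fun _ => D) t) ∂ν)

/-- The hypotheses on a non-increasing converging moving boundary `A`. -/
structure ConvergingBoundary [TopologicalSpace I] [OrderTopology I] [TopologicalSpace E]
    (M : MarkovFamily I E Ω) (A : I → Set E) : Prop where
  measurable_boundary : ∀ t, MeasurableSet (A t)
  /-- The hitting times are stopping times of the natural filtration. -/
  stopping : ∀ s, IsStoppingTime M.filtration (M.hit (shiftBoundary A s))
  stopping_limit : IsStoppingTime M.filtration (M.hit fun _ => limitBoundary A)
  /-- Absorption is almost sure, and survival up to any time has positive probability. -/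
  absorbed : ∀ s, ∀ x ∈ (A s)ᶜ, ∀ᵐ ω ∂(M.P x), M.hit (shiftBoundary A s) ω < ⊤
  survival_pos : ∀ s t, ∀ x ∈ (A s)ᶜ, 0 < M.P x (M.survive (shiftBoundary A s) t)
  /-- `A` is non-increasing and converges, i.e. `A_∞` is non-empty. -/
  antitone : Antitone A
  limit_nonempty : (limitBoundary A).Nonempty
  moving : MovingCV M A
  fixed : FixedCV M (limitBoundary A)
  strongMarkov : M.StrongMarkov
  /-- `τ_{A ∘ θ_s}` converges in law to `τ_{A_∞}` as `s → ∞`, under each `P_x` with `x ∈ E_0`. -/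
  hit_tendsto : ∀ x ∈ (A 0)ᶜ, ∀ f : WithTop I →ᵇ ℝ,
    Tendsto (fun s => ∫ ω, f (M.hit (shiftBoundary A s) ω) ∂(M.P x)) atTop
      (𝓝 (∫ ω, f (M.hit (fun _ => limitBoundary A) ω) ∂(M.P x)))
  continuous_time : ∀ x ∈ (A 0)ᶜ, ∀ s,
    Continuous fun t => M.P x (M.survive (shiftBoundary A s) t)
  continuous_time_limit : ∀ x ∈ (A 0)ᶜ,
    Continuous fun t => M.P x (M.survive (fun _ => limitBoundary A) t)
  /-- Continuity in the starting point, for positive times (at `t = 0` the function is in general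
  the indicator function of `E_∞`). -/
  continuous_state : ∀ t, 0 < t →
    Continuous fun x => M.P x (M.survive (fun _ => limitBoundary A) t)

/-! ### The `Q`-process -/

/-- The trajectory `X_{[0,t]}`. -/
def MarkovFamily.traj (M : MarkovFamily I E Ω) (t : I) (ω : Ω) : Set.Iic t → E :=
  fun r => M.X r ω

/-- `Q s t x` is the law of the trajectory on `[s, s+t]` (reindexed by `[0,t]`) of the `Q`-process
started at time `s` from `x`: for every measurable set `B` of trajectories,
`P_x(X_{[0,t]} ∈ B | τ_{A ∘ θ_s} > t + T) → Q_{s,x}(X_{[s,s+t]} ∈ B)` as `T → ∞`. -/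
def IsQProcess (M : MarkovFamily I E Ω) (A : I → Set E)
    (Q : (s t : I) → E → Measure (Set.Iic t → E)) : Prop :=
  ∀ s t, ∀ x ∈ (A s)ᶜ, IsProbabilityMeasure (Q s t x) ∧
    ∀ B : Set (Set.Iic t → E), MeasurableSet B →
      Tendsto (fun T => (M.condP (shiftBoundary A s) x (t + T)).map (M.traj t) B) atTop
        (𝓝 (Q s t x B))

/-- `Q_{s,μ}(X_{s+t} ∈ ·) = ∫ Q_{s,x}(X_{s+t} ∈ ·) μ(dx)`. -/
noncomputable def qLaw (Q : (s t : I) → E → Measure (Set.Iic t → E)) (s t : I) (μ : Measure E) :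
    Measure E :=
  μ.bind fun x => (Q s t x).map fun w => w ⟨t, le_rfl⟩

/-- `β` is an invariant probability measure, carried by `Dᶜ`, of the time-homogeneous `Q`-process
`Q` of `X` absorbed by the fixed set `D`. -/
def IsInvariantLaw (D : Set E) (Q : (s t : I) → E → Measure (Set.Iic t → E)) (β : Measure E) :
    Prop :=
  IsLawOn β Dᶜ ∧ ∀ t, qLaw Q 0 t β = β

end Generic

/-- Convergence in law (tested against bounded continuous functions). -/
def ConvergesInLaw {I E : Type*} [Preorder I] [TopologicalSpace E] [MeasurableSpace E]
    (m : I → Measure E) (β : Measure E) : Prop :=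
  ∀ f : E →ᵇ ℝ, Tendsto (fun t => ∫ y, f y ∂(m t)) atTop (𝓝 (∫ y, f y ∂β))

/-- `(1/t) ∫_0^t P_x(X_s ∈ · | τ_A > t) ds`, in continuous time. -/
noncomputable def timeAverage {E Ω : Type*} [MeasurableSpace E] [MeasurableSpace Ω]
    (M : MarkovFamily ℝ≥0 E Ω) (A : ℝ≥0 → Set E) (x : E) (t : ℝ≥0) : Measure E :=
  t⁻¹ • ((volume : Measure ℝ).restrict (Set.Ioc 0 (t : ℝ))).bind
    fun s => M.condLaw A x s.toNNReal t

/-- `(1/n) ∑_{k=0}^n P_x(X_k ∈ · | τ_A > n)`, in discrete time. -/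
noncomputable def discreteTimeAverage {E Ω : Type*} [MeasurableSpace E] [MeasurableSpace Ω]
    (M : MarkovFamily ℕ E Ω) (A : ℕ → Set E) (x : E) (n : ℕ) : Measure E :=
  (n : ℝ≥0)⁻¹ • ∑ k ∈ Finset.range (n + 1), M.condLaw A x k n

end MovingBoundary

/-! Conditioned on survival up to a distant horizon, the process is an inhomogeneous Markov process
satisfying a Doeblin condition: whatever the horizon and the starting point, the laws after one
block of length `t₀` share a part of mass `c₁ * c₂` (`exists_minorizing`). After `n` blocks the
influence of the starting point is at most `(1 - c₁ * c₂) ^ n`, uniformly in the horizon and the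
starting time (`integral_condLaw_sub_le`).

This contraction gives the `Q`-processes. Extending the horizon reweights the past up to time `t` by
a function of `X_t` that is nearly constant, so the conditional laws of the trajectory are Cauchy
uniformly over measurable sets (`abs_condP_sub_le`). For the fixed set `A_∞` the limit is a
semigroup that forgets its starting point, hence has a unique invariant law `β` (`exists_limit_law`,
`eq_of_isInvariantLaw`).

The two boundaries are compared from a single point `y` of `E_0` with fixed durations `u` and `T`.
By loss of memory, the moving `Q`-process at a late time is close to the law at time `u` started
from `y` at a late time `r`, conditioned to survive until `u + T`. Convergence in law of the hitting
times, together with inclusion of the survival events, allows `A ∘ θ_r` to be replaced by `A_∞` as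
`r → ∞` (`eventually_condLaw_close`), and the law so obtained is close to `β`
(`exists_forall_endLaw_close`). Since `u` and `T` are chosen before `r`, convergence at one point
and one time is enough. For the averages, the conditional law is close to `β` except near the two
ends of the time interval, which have bounded length. All estimates are uniform over measurable
sets, which is stronger than weak convergence. -/

namespace MovingBoundary

/-- A real function that varies by at most `a` on a nonempty set takes its values there in an
interval of length `a`. -/
lemma exists_bounds_of_sub_le {γ : Type*} {S : Set γ} (hS : S.Nonempty) {f : γ → ℝ} {a : ℝ}
    (hf : ∀ x ∈ S, ∀ y ∈ S, f x - f y ≤ a) : ∃ b, ∀ x ∈ S, b ≤ f x ∧ f x ≤ b + a := by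
  have hne : (f '' S).Nonempty := hS.image f
  have hbdd : ∀ x ∈ S, f x - a ∈ lowerBounds (f '' S) := by
    rintro x hx _ ⟨y, hy, rfl⟩
    linarith [hf x hx y hy]
  obtain ⟨x₀, hx₀⟩ := hS
  refine ⟨sInf (f '' S), fun x hx => ⟨csInf_le ⟨_, hbdd x₀ hx₀⟩ ⟨x, hx, rfl⟩, ?_⟩⟩
  linarith [le_csInf hne (hbdd x hx)]

/-! ### Uniform distance between measures and Doeblin contraction. -/

section Measures

variable {α β : Type*} [MeasurableSpace α] [MeasurableSpace β]

/-- The two measures differ by at most `ε` on every measurable set. -/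
def UniformlyClose (μ μ' : Measure α) (ε : ℝ) : Prop :=
  ∀ B, MeasurableSet B → |μ.real B - μ'.real B| ≤ ε

lemma UniformlyClose.symm {μ μ' : Measure α} {ε : ℝ} (h : UniformlyClose μ μ' ε) :
    UniformlyClose μ' μ ε := fun B hB => by
  rw [abs_sub_comm]; exact h B hB

lemma UniformlyClose.trans {μ μ' μ'' : Measure α} {ε δ : ℝ} (h : UniformlyClose μ μ' ε)
    (h' : UniformlyClose μ' μ'' δ) : UniformlyClose μ μ'' (ε + δ) := fun B hB =>
  (abs_sub_le _ _ _).trans (add_le_add (h B hB) (h' B hB))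

lemma UniformlyClose.mono {μ μ' : Measure α} {ε δ : ℝ} (h : UniformlyClose μ μ' ε) (hε : ε ≤ δ) :
    UniformlyClose μ μ' δ := fun B hB => (h B hB).trans hε

lemma UniformlyClose.map {μ μ' : Measure α} {ε : ℝ} (h : UniformlyClose μ μ' ε) {g : α → β}
    (hg : Measurable g) : UniformlyClose (μ.map g) (μ'.map g) ε := fun B hB => by
  rw [map_measureReal_apply hg hB, map_measureReal_apply hg hB]
  exact h _ (hg hB)

/-- By the layer-cake formula both integrals are averages over `t ∈ (0, 1]` of the masses of `{t ≤
f}`, which differ by at most `ε`; no constant is lost. -/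
lemma UniformlyClose.abs_integral_sub_le_of_unit {μ μ' : Measure α} [IsFiniteMeasure μ]
    [IsFiniteMeasure μ'] {ε : ℝ} (h : UniformlyClose μ μ' ε) {f : α → ℝ} (hf : Measurable f)
    (h0 : ∀ x, 0 ≤ f x) (h1 : ∀ x, f x ≤ 1) : |∫ x, f x ∂μ - ∫ x, f x ∂μ'| ≤ ε := by
  have hint : ∀ (ρ : Measure α) [IsFiniteMeasure ρ], Integrable f ρ := fun ρ _ =>
    Integrable.of_bound hf.aestronglyMeasurable 1
      (Eventually.of_forall fun x => by rw [Real.norm_of_nonneg (h0 x)]; exact h1 x)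
  have hlayer : ∀ (ρ : Measure α) [IsFiniteMeasure ρ],
      ∫ x, f x ∂ρ = ∫ t in Set.Ioc (0 : ℝ) 1, ρ.real {a | t ≤ f a} := fun ρ _ =>
    (hint ρ).integral_eq_integral_Ioc_meas_le (Eventually.of_forall h0) (Eventually.of_forall h1)
  have hlint : ∀ (ρ : Measure α) [IsFiniteMeasure ρ],
      Integrable (fun t : ℝ => ρ.real {a | t ≤ f a}) (volume.restrict (Set.Ioc (0 : ℝ) 1)) := by
    intro ρ _
    have hanti : Antitone fun t : ℝ => ρ.real {a | t ≤ f a} := fun s t hst =>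
      measureReal_mono (fun a (ha : t ≤ f a) => hst.trans ha)
    refine Integrable.of_bound hanti.measurable.aestronglyMeasurable (ρ.real Set.univ)
      (Eventually.of_forall fun t => ?_)
    rw [Real.norm_of_nonneg measureReal_nonneg]
    exact measureReal_mono (Set.subset_univ _)
  rw [hlayer μ, hlayer μ', ← integral_sub (hlint μ) (hlint μ')]
  have := norm_integral_le_of_norm_le_const (μ := volume.restrict (Set.Ioc (0 : ℝ) 1))
    (f := fun t : ℝ => μ.real {a | t ≤ f a} - μ'.real {a | t ≤ f a}) (C := ε)
    (Eventually.of_forall fun t => h _ (measurableSet_le measurable_const hf))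
  simpa using this

/-- Rescaling `f` to `[0, 1]` costs a factor `2 * C`. The additional `C` accounts for the difference
of total masses, needed because the discrete time averages have mass `(n + 1) / n`. -/
lemma UniformlyClose.abs_integral_sub_le {μ μ' : Measure α} [IsFiniteMeasure μ]
    [IsFiniteMeasure μ'] {ε : ℝ} (h : UniformlyClose μ μ' ε) {f : α → ℝ} (hf : Measurable f)
    {C : ℝ} (hC : 0 < C) (hfC : ∀ x, |f x| ≤ C) : |∫ x, f x ∂μ - ∫ x, f x ∂μ'| ≤ 3 * C * ε := by
  have hunit := h.abs_integral_sub_le_of_unit (f := fun x => (f x + C) / (2 * C))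
    ((hf.add_const C).div_const _)
    (fun x => div_nonneg (by linarith [(abs_le.1 (hfC x)).1]) (by linarith))
    (fun x => (div_le_one (by linarith)).2 (by linarith [(abs_le.1 (hfC x)).2]))
  have heq : ∀ (ρ : Measure α) [IsFiniteMeasure ρ],
      ∫ x, f x ∂ρ = 2 * C * ∫ x, (f x + C) / (2 * C) ∂ρ - C * ρ.real Set.univ := by
    intro ρ _
    have hint : Integrable f ρ :=
      Integrable.of_bound hf.aestronglyMeasurable C (Eventually.of_forall hfC)
    rw [integral_div, integral_add hint (integrable_const _), integral_const, smul_eq_mul]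
    field_simp
    ring
  have huniv := h Set.univ MeasurableSet.univ
  rw [heq μ, heq μ']
  rw [abs_le] at *
  constructor <;> nlinarith [mul_le_mul_of_nonneg_left hunit.1 hC.le,
    mul_le_mul_of_nonneg_left hunit.2 hC.le, mul_le_mul_of_nonneg_left huniv.1 hC.le,
    mul_le_mul_of_nonneg_left huniv.2 hC.le]

/-- A sequence of probability measures that is Cauchy uniformly over measurable sets converges
uniformly over measurable sets. -/
lemma exists_limit_of_uniformlyClose (μ : ℕ → Measure α) [∀ n, IsProbabilityMeasure (μ n)]
    {r : ℕ → ℝ} (hr : Tendsto r atTop (𝓝 0))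
    (h : ∀ n m, n ≤ m → UniformlyClose (μ m) (μ n) (r n)) :
    ∃ μ' : Measure α, IsProbabilityMeasure μ' ∧ ∀ n, UniformlyClose (μ n) μ' (r n) := by
  have hex : ∀ B, ∃ l : ℝ, MeasurableSet B → Tendsto (fun n => (μ n).real B) atTop (𝓝 l) := by
    intro B
    by_cases hB : MeasurableSet B
    · have hc : CauchySeq fun n => (μ n).real B := by
        refine cauchySeq_of_le_tendsto_0' r (fun n m hnm => ?_) hr
        rw [dist_comm, Real.dist_eq]
        exact h n m hnm B hB
      obtain ⟨l, hl⟩ := cauchySeq_tendsto_of_complete hc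
      exact ⟨l, fun _ => hl⟩
    · exact ⟨0, fun h => absurd h hB⟩
  choose l hl using hex
  have hl0 : ∀ B, MeasurableSet B → 0 ≤ l B := fun B hB =>
    ge_of_tendsto' (hl B hB) fun n => measureReal_nonneg
  have hlr : ∀ n B, MeasurableSet B → |(μ n).real B - l B| ≤ r n := by
    intro n B hB
    refine le_of_tendsto (((hl B hB).const_sub ((μ n).real B)).abs) ?_
    filter_upwards [eventually_ge_atTop n] with m hm
    rw [abs_sub_comm]
    exact h n m hm B hB
  have hlfin : ∀ f : ℕ → Set α, (∀ i, MeasurableSet (f i)) → Pairwise (Function.onFun Disjoint f) →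
      ∀ k, l (⋃ i ∈ Finset.range k, f i) = ∑ i ∈ Finset.range k, l (f i) := by
    intro f hf hd k
    refine tendsto_nhds_unique
      (hl _ (Finset.measurableSet_biUnion _ fun i _ => hf i)) ?_
    have : ∀ n, (μ n).real (⋃ i ∈ Finset.range k, f i) = ∑ i ∈ Finset.range k, (μ n).real (f i) :=
      fun n => measureReal_biUnion_finset (fun i _ j _ hij => hd hij) fun i _ => hf i
    simp_rw [this]
    exact tendsto_finsetSum _ fun i _ => hl _ (hf i)
  have hlsum : ∀ f : ℕ → Set α, (∀ i, MeasurableSet (f i)) → Pairwise (Function.onFun Disjoint f) →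
      HasSum (fun i => l (f i)) (l (⋃ i, f i)) := by
    intro f hf hd
    rw [hasSum_iff_tendsto_nat_of_nonneg (fun i => hl0 _ (hf i))]
    simp_rw [← hlfin f hf hd]
    -- Countable additivity of the setwise limit is an exchange of the limits in `n` and `k`,
    -- legitimate because the error `r n` is the same for every set.
    have hunif : TendstoUniformly (fun n k => (μ n).real (⋃ i ∈ Finset.range k, f i))
        (fun k => l (⋃ i ∈ Finset.range k, f i)) atTop := by
      rw [Metric.tendstoUniformly_iff]
      intro ε hε
      filter_upwards [hr.eventually (gt_mem_nhds hε)] with n hn k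
      rw [dist_comm, Real.dist_eq]
      exact (hlr n _ (Finset.measurableSet_biUnion _ fun i _ => hf i)).trans_lt hn
    refine hunif.tendsto_of_eventually_tendsto (L := fun n => (μ n).real (⋃ i, f i))
      (Eventually.of_forall fun n => ?_) (hl _ (MeasurableSet.iUnion hf))
    have hU : (⋃ i, f i) = ⋃ k, ⋃ i ∈ Finset.range k, f i := by
      ext x
      simp only [Set.mem_iUnion, Finset.mem_range]
      exact ⟨fun ⟨i, hi⟩ => ⟨i + 1, i, Nat.lt_succ_self i, hi⟩, fun ⟨_, i, _, hi⟩ => ⟨i, hi⟩⟩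
    rw [hU]
    refine (ENNReal.tendsto_toReal (measure_ne_top _ _)).comp (tendsto_measure_iUnion_atTop ?_)
    intro a b hab
    exact Set.biUnion_subset_biUnion_left fun i hi =>
      Finset.mem_coe.2 (Finset.range_mono hab (Finset.mem_coe.1 hi))
  have hlempty : l ∅ = 0 := by
    refine tendsto_nhds_unique (hl ∅ MeasurableSet.empty) ?_
    simp
  let μ' : Measure α := Measure.ofMeasurable (fun B _ => ENNReal.ofReal (l B))
    (by simp [hlempty]) (fun f hf hd => by
      rw [← (hlsum f hf hd).tsum_eq, ENNReal.ofReal_tsum_of_nonneg (fun i => hl0 _ (hf i))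
        (hlsum f hf hd).summable])
  have hμ' : ∀ B, MeasurableSet B → μ' B = ENNReal.ofReal (l B) := fun B hB =>
    Measure.ofMeasurable_apply B hB
  refine ⟨μ', ⟨?_⟩, fun n B hB => ?_⟩
  · rw [hμ' _ MeasurableSet.univ]
    have : l Set.univ = 1 := by
      refine tendsto_nhds_unique (hl _ MeasurableSet.univ) ?_
      simp
    simp [this]
  · rw [measureReal_def μ', hμ' B hB, ENNReal.toReal_ofReal (hl0 B hB)]
    exact hlr n B hB

lemma nonempty_of_measure_compl_eq_zero {S : Set α} {μ : Measure α} [IsProbabilityMeasure μ]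
    (h : μ Sᶜ = 0) : S.Nonempty := by
  by_contra hS
  rw [Set.not_nonempty_iff_eq_empty] at hS
  simp [hS] at h

lemma integrable_of_sub_le {S : Set α} {μ : Measure α} [IsProbabilityMeasure μ] (hμ : μ Sᶜ = 0)
    {f : α → ℝ} (hfm : Measurable f) {a : ℝ} (hf : ∀ x ∈ S, ∀ y ∈ S, f x - f y ≤ a) :
    Integrable f μ := by
  obtain ⟨b, hb⟩ := exists_bounds_of_sub_le (nonempty_of_measure_compl_eq_zero hμ) hf
  refine Integrable.of_bound hfm.aestronglyMeasurable (max |b| |b + a|) ?_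
  have : ∀ᵐ x ∂μ, x ∈ S := by rwa [ae_iff]
  filter_upwards [this] with x hx
  exact abs_le_max_abs_abs (hb x hx).1 (hb x hx).2

lemma integral_sub_le_of_sub_le {S : Set α} {μ : Measure α} [IsProbabilityMeasure μ]
    (hμ : μ Sᶜ = 0) {f : α → ℝ} (hfm : Measurable f) {a : ℝ}
    (hf : ∀ x ∈ S, ∀ y ∈ S, f x - f y ≤ a) {x : α} (hx : x ∈ S) : |f x - ∫ y, f y ∂μ| ≤ a := by
  have hint := integrable_of_sub_le hμ hfm hf
  have hS : ∀ᵐ x ∂μ, x ∈ S := by rwa [ae_iff]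
  have h1 : ∫ y, (f x - a) ∂μ ≤ ∫ y, f y ∂μ := integral_mono_ae (integrable_const _) hint (by
    filter_upwards [hS] with y hy
    linarith [hf x hx y hy])
  have h2 : ∫ y, f y ∂μ ≤ ∫ y, (f x + a) ∂μ := integral_mono_ae hint (integrable_const _) (by
    filter_upwards [hS] with y hy
    linarith [hf y hy x hx])
  simp only [integral_const, probReal_univ, one_smul] at h1 h2
  rw [abs_le]
  constructor <;> linarith

lemma integral_sub_integral_le_of_sub_le {S : Set α} {μ μ' : Measure α} [IsProbabilityMeasure μ]
    [IsProbabilityMeasure μ'] (hμ : μ Sᶜ = 0) (hμ' : μ' Sᶜ = 0) {f : α → ℝ} (hfm : Measurable f)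
    {a : ℝ} (hf : ∀ x ∈ S, ∀ y ∈ S, f x - f y ≤ a) : ∫ x, f x ∂μ - ∫ x, f x ∂μ' ≤ a := by
  have hS : ∀ᵐ x ∂μ, x ∈ S := by rwa [ae_iff]
  have h1 : ∫ x, f x ∂μ ≤ ∫ _, (∫ y, f y ∂μ' + a) ∂μ :=
    integral_mono_ae (integrable_of_sub_le hμ hfm hf) (integrable_const _) (by
      filter_upwards [hS] with x hx
      linarith [(abs_le.1 (integral_sub_le_of_sub_le hμ' hfm hf hx)).2])
  simp only [integral_const, probReal_univ, one_smul] at h1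
  linarith

lemma integral_bind_kernel {μ : Measure α} [SFinite μ] {κ : Kernel α β} [IsSFiniteKernel κ]
    {f : β → ℝ} (hf : Integrable f (μ.bind κ)) :
    ∫ y, f y ∂(μ.bind κ) = ∫ x, ∫ y, f y ∂(κ x) ∂μ := by
  have h : (κ ∘ₖ Kernel.const Unit μ) () = μ.bind κ := by
    rw [Kernel.comp_apply, Kernel.const_apply]
  rw [← h] at hf ⊢
  rw [Kernel.integral_comp hf, Kernel.const_apply]

/-- Doeblin contraction: two probability measures with a common part of mass `c` integrate a
function of oscillation `a` to values at distance at most `(1 - c) a`. -/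
lemma integral_sub_integral_le_of_minorized {S : Set α} {μ μ' m : Measure α}
    [IsProbabilityMeasure μ] [IsProbabilityMeasure μ'] [IsProbabilityMeasure m]
    (hμ : μ Sᶜ = 0) (hμ' : μ' Sᶜ = 0) {c : ℝ≥0} (hc : 0 < c) (hm : c • m ≤ μ) (hm' : c • m ≤ μ')
    {f : α → ℝ} (hfm : Measurable f) {a : ℝ} (hf : ∀ x ∈ S, ∀ y ∈ S, f x - f y ≤ a) :
    ∫ x, f x ∂μ - ∫ x, f x ∂μ' ≤ (1 - c) * a := by
  obtain ⟨b, hb⟩ := exists_bounds_of_sub_le (nonempty_of_measure_compl_eq_zero hμ) hf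
  have hmS : m Sᶜ = 0 := by
    have := hm Sᶜ
    rw [hμ, nonpos_iff_eq_zero, Measure.smul_apply] at this
    simpa [hc.ne', ENNReal.smul_def] using this
  have i1 := integrable_of_sub_le hμ hfm hf
  have i2 := integrable_of_sub_le hμ' hfm hf
  have i3 := integrable_of_sub_le hmS hfm hf
  -- Both `b + a - f` and `f - b` are nonnegative on `S`, so each integrates to at least its
  -- integral against `c • m`. In the sum of the two inequalities `∫ f ∂m` cancels and `c * a`
  -- remains.
  have h1 : ∫ x, (b + a - f x) ∂(c • m) ≤ ∫ x, (b + a - f x) ∂μ :=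
    integral_mono_measure hm (by
      have : ∀ᵐ x ∂μ, x ∈ S := by rwa [ae_iff]
      filter_upwards [this] with x hx
      simpa using (hb x hx).2) ((integrable_const _).sub i1)
  have h2 : ∫ x, (f x - b) ∂(c • m) ≤ ∫ x, (f x - b) ∂μ' :=
    integral_mono_measure hm' (by
      have : ∀ᵐ x ∂μ', x ∈ S := by rwa [ae_iff]
      filter_upwards [this] with x hx
      simpa using (hb x hx).1) (i2.sub (integrable_const _))
  rw [integral_smul_nnreal_measure, integral_sub (integrable_const _) i3,
    integral_sub (integrable_const _) i1] at h1
  rw [integral_smul_nnreal_measure, integral_sub i3 (integrable_const _),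
    integral_sub i2 (integrable_const _)] at h2
  simp only [integral_const, probReal_univ, NNReal.smul_def, smul_eq_mul] at h1 h2
  linarith

lemma ConvergesInLaw.of_uniformlyClose {I E : Type*} [Preorder I] [TopologicalSpace E]
    [MeasurableSpace E] [OpensMeasurableSpace E] {m : I → Measure E} {β : Measure E}
    [IsFiniteMeasure β]
    (h : ∀ ε > 0, ∀ᶠ t in atTop, IsFiniteMeasure (m t) ∧ UniformlyClose (m t) β ε) :
    ConvergesInLaw m β := by
  intro f
  rw [Metric.tendsto_nhds]
  intro ε hε
  have hC : 0 < ‖f‖ + 1 := by positivity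
  have hpos : 0 < ε / (6 * (‖f‖ + 1)) := by positivity
  filter_upwards [h _ hpos] with t ⟨ht, hclose⟩
  rw [Real.dist_eq]
  refine (hclose.abs_integral_sub_le f.continuous.measurable hC
    (fun x => (f.norm_coe_le_norm x).trans (by linarith))).trans_lt ?_
  field_simp
  linarith

end Measures

/-! ### Time shifts of the boundary. -/

section Shift

variable {I E : Type*} [AddCommMonoid I]

lemma shiftBoundary_shiftBoundary (A : I → Set E) (s t : I) :
    shiftBoundary (shiftBoundary A s) t = shiftBoundary A (s + t) := by
  funext r
  simp [shiftBoundary, add_assoc]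

lemma shiftBoundary_zero (A : I → Set E) : shiftBoundary A 0 = A := by
  funext r
  simp [shiftBoundary]

lemma shiftBoundary_apply_zero (A : I → Set E) (s : I) : shiftBoundary A s 0 = A s := by
  simp [shiftBoundary]

end Shift

/-! ### Survival events and the Markov property. -/

section Paths

variable {I E Ω : Type*} [AddCommMonoid I] [ConditionallyCompleteLinearOrderBot I]
  [MeasurableSpace I] [MeasurableSpace E] [MeasurableSpace Ω]

attribute [instance] MarkovFamily.isMarkovKernel

lemma MarkovFamily.notMem_of_mem_survive (M : MarkovFamily I E Ω) {A : I → Set E} {t r : I} {ω : Ω}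
    (h : ω ∈ M.survive A t) (hr : r ≤ t) : M.X r ω ∉ A r := fun hmem =>
  absurd (sInf_le ⟨r, hmem, rfl⟩ : M.hit A ω ≤ r)
    (not_le.2 (lt_of_le_of_lt (WithTop.coe_le_coe.2 hr) h))

lemma MarkovFamily.survive_antitone (M : MarkovFamily I E Ω) (A : I → Set E) {s t : I}
    (h : s ≤ t) : M.survive A t ⊆ M.survive A s := fun _ hω =>
  lt_of_le_of_lt (WithTop.coe_le_coe.2 h) hω

lemma MarkovFamily.survive_mono (M : MarkovFamily I E Ω) {A A' : I → Set E} (h : ∀ t, A' t ⊆ A t)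
    (t : I) : M.survive A t ⊆ M.survive A' t := fun _ hω =>
  lt_of_lt_of_le (b := M.hit A _) hω
    (sInf_le_sInf (Set.image_mono fun r (hr : M.X r _ ∈ A' r) => h r hr))

lemma MarkovFamily.survive_subset_limit (M : MarkovFamily I E Ω) (A : I → Set E) (s t : I) :
    M.survive (shiftBoundary A s) t ⊆ M.survive (fun _ => limitBoundary A) t :=
  M.survive_mono (fun _ => Set.iInter_subset A _) t

lemma MarkovFamily.filtration_le_iSup (M : MarkovFamily I E Ω) (t : I) :
    (M.filtration t : MeasurableSpace Ω) ≤ ⨆ r, (M.filtration r : MeasurableSpace Ω) :=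
  le_iSup (fun r => (M.filtration r : MeasurableSpace Ω)) t

lemma MarkovFamily.iSup_filtration_le (M : MarkovFamily I E Ω) :
    ⨆ r, (M.filtration r : MeasurableSpace Ω) ≤ ‹MeasurableSpace Ω› :=
  iSup_le fun r => M.filtration.le r

lemma MarkovFamily.measurable_X_filtration (M : MarkovFamily I E Ω) {r t : I} (h : r ≤ t) :
    Measurable[M.filtration t] (M.X r) := by
  rw [measurable_iff_comap_le]
  exact le_iSup₂ (f := fun r (_ : r ≤ t) => MeasurableSpace.comap (M.X r) ‹MeasurableSpace E›) r h

lemma MarkovFamily.measurable_traj_filtration (M : MarkovFamily I E Ω) (t : I) :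
    Measurable[M.filtration t] (M.traj t) :=
  @measurable_pi_lambda _ _ _ (M.filtration t) _ _ fun r => M.measurable_X_filtration r.2

lemma MarkovFamily.measurable_traj (M : MarkovFamily I E Ω) (t : I) : Measurable (M.traj t) :=
  measurable_pi_lambda _ fun r => M.measurable_X r

/-- Applied to the events `F ∩ {X_t ∈ B}`, the Markov property says that restricting to `shift t ⁻¹'
Λ` multiplies the image of `P_x` restricted to `F` under `X_t` by the density `y ↦ P_y(Λ)`. -/
lemma MarkovFamily.markov_lintegral (M : MarkovFamily I E Ω) (x : E) (t : I) {F Λ : Set Ω}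
    (hF : MeasurableSet[M.filtration t] F) (hΛ : MeasurableSet[⨆ r, M.filtration r] Λ)
    {g : E → ℝ≥0∞} (hg : Measurable g) :
    ∫⁻ ω in F ∩ M.shift t ⁻¹' Λ, g (M.X t ω) ∂(M.P x) =
      ∫⁻ ω in F, g (M.X t ω) * M.P (M.X t ω) Λ ∂(M.P x) := by
  have hΛ' := M.iSup_filtration_le _ hΛ
  have hPΛ : Measurable fun y => M.P y Λ := Kernel.measurable_coe _ hΛ'
  have key : ((M.P x).restrict (F ∩ M.shift t ⁻¹' Λ)).map (M.X t) =
      (((M.P x).restrict F).map (M.X t)).withDensity fun y => M.P y Λ := by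
    ext B hB
    rw [Measure.map_apply (M.measurable_X t) hB, withDensity_apply _ hB,
      Measure.restrict_apply (M.measurable_X t hB),
      setLIntegral_map hB hPΛ (M.measurable_X t),
      Measure.restrict_restrict (M.measurable_X t hB), ← Set.inter_assoc]
    exact M.markov x t _ Λ ((M.measurable_X_filtration le_rfl hB).inter hF) hΛ
  rw [← lintegral_map hg (M.measurable_X t), key,
    lintegral_withDensity_eq_lintegral_mul _ hPΛ hg, lintegral_map (hPΛ.mul hg) (M.measurable_X t)]
  simp only [Pi.mul_apply, mul_comm]

variable [IsOrderedCancelAddMonoid I] [CanonicallyOrderedAdd I]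

/-- The strict inequality `t + u < τ_A` asks for a gap after `t + u` without hits, not only for
avoidance up to `t + u`. What is transported by `t + ·` is therefore a lower bound of the hitting
times lying strictly beyond the given time. -/
lemma MarkovFamily.survive_add (M : MarkovFamily I E Ω) (A : I → Set E) (t u : I) :
    M.survive A (t + u) = M.survive A t ∩ M.shift t ⁻¹' M.survive (shiftBoundary A t) u := by
  ext ω
  constructor
  · intro h
    refine ⟨M.survive_antitone A le_self_add h, ?_⟩
    change (u : WithTop I) < M.hit (shiftBoundary A t) (M.shift t ω)
    obtain ⟨b, hb, hbl⟩ := lt_sInf_iff.1 (show ((t + u : I) : WithTop I) < M.hit A ω from h)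
    have hmem : ∀ r, M.X r (M.shift t ω) ∈ shiftBoundary A t r → b ≤ ((t + r : I) : WithTop I) := by
      intro r hr
      refine hbl ⟨t + r, ?_, rfl⟩
      simpa [shiftBoundary, M.X_shift] using hr
    induction b with
    | top =>
      have : M.hit (shiftBoundary A t) (M.shift t ω) = ⊤ := by
        refine sInf_eq_top.2 ?_
        rintro _ ⟨r, hr, rfl⟩
        exact absurd (hmem r hr) (by simp)
      rw [this]
      exact WithTop.coe_lt_top u
    | coe b =>
      have hb' := WithTop.coe_lt_coe.1 hb
      obtain ⟨d, rfl⟩ := le_iff_exists_add.1 ((le_self_add (a := t) (b := u)).trans hb'.le)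
      refine lt_sInf_iff.2 ⟨d, WithTop.coe_lt_coe.2 (lt_of_add_lt_add_left hb'), ?_⟩
      rintro _ ⟨r, hr, rfl⟩
      exact WithTop.coe_le_coe.2 (le_of_add_le_add_left (WithTop.coe_le_coe.1 (hmem r hr)))
  · rintro ⟨h1, h2⟩
    change (u : WithTop I) < M.hit (shiftBoundary A t) (M.shift t ω) at h2
    change ((t + u : I) : WithTop I) < M.hit A ω
    have hmem : ∀ r, M.X r ω ∈ A r → ∃ d, r = t + d ∧
        M.hit (shiftBoundary A t) (M.shift t ω) ≤ d := by
      intro r hr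
      have hlt : t < r := not_le.1 fun hrt => M.notMem_of_mem_survive h1 hrt hr
      obtain ⟨d, rfl⟩ := le_iff_exists_add.1 hlt.le
      refine ⟨d, rfl, sInf_le ⟨d, ?_, rfl⟩⟩
      simpa [shiftBoundary, M.X_shift] using hr
    rcases h : M.hit (shiftBoundary A t) (M.shift t ω) with _ | b
    · have : M.hit A ω = ⊤ := by
        refine sInf_eq_top.2 ?_
        rintro _ ⟨r, hr, rfl⟩
        obtain ⟨d, -, hd⟩ := hmem r hr
        rw [h] at hd
        exact absurd hd (by simp [WithTop.none_eq_top])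
      rw [this]
      exact WithTop.coe_lt_top _
    · rw [h] at h2
      have h2' : u < b := WithTop.coe_lt_coe.1 h2
      refine lt_sInf_iff.2 ⟨((t + b : I) : WithTop I),
        WithTop.coe_lt_coe.2 (add_lt_add_right h2' t), ?_⟩
      rintro _ ⟨r, hr, rfl⟩
      obtain ⟨d, rfl, hd⟩ := hmem r hr
      rw [h] at hd
      exact WithTop.coe_le_coe.2 (add_le_add_right (WithTop.coe_le_coe.1 hd) t)

end Paths

/-! ### Contraction for the process conditioned to survive. -/

section Conditioned

variable {I E Ω : Type*} [AddCommMonoid I] [ConditionallyCompleteLinearOrderBot I]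
  [MeasurableSpace I] [MeasurableSpace E] [MeasurableSpace Ω]

/-- The Champagnat–Villemonais conditions for a moving boundary, with explicit constants. -/
structure UniformCV (M : MarkovFamily I E Ω) (A : I → Set E) (ν : I → Measure E) (t₀ : I)
    (c₁ c₂ : ℝ≥0) : Prop where
  measurable_boundary : ∀ t, MeasurableSet (A t)
  measurable_survive : ∀ s t, MeasurableSet[M.filtration t] (M.survive (shiftBoundary A s) t)
  survival_pos : ∀ s t, ∀ x ∈ (A s)ᶜ, 0 < M.P x (M.survive (shiftBoundary A s) t)
  c₁_pos : 0 < c₁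
  c₂_pos : 0 < c₂
  isLawOn : ∀ s, IsLawOn (ν s) (A s)ᶜ
  minorized : ∀ s, ∀ x ∈ (A s)ᶜ, c₁ • ν (s + t₀) ≤ M.condLaw (shiftBoundary A s) x t₀ t₀
  comparison : ∀ s t, ∀ x ∈ (A s)ᶜ, (c₂ : ℝ≥0∞) * M.P x (M.survive (shiftBoundary A s) t) ≤
    ∫⁻ y, M.P y (M.survive (shiftBoundary A s) t) ∂(ν s)

/-- The kernel `x ↦ P_x(X_t ∈ · | τ_A > u)`. -/
noncomputable def MarkovFamily.condLawKernel (M : MarkovFamily I E Ω) (A : I → Set E) (t u : I)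
    (hS : MeasurableSet (M.survive A u)) : Kernel E E where
  toFun x := M.condLaw A x t u
  measurable' := by
    refine Measure.measurable_of_measurable_coe _ fun B hB => ?_
    have : (fun x => M.condLaw A x t u B) =
        fun x => (M.P x (M.survive A u))⁻¹ * M.P x (M.survive A u ∩ M.X t ⁻¹' B) := by
      funext x
      rw [MarkovFamily.condLaw, Measure.map_apply (M.measurable_X t) hB, MarkovFamily.condP,
        cond_apply hS]
    rw [this]
    exact (Kernel.measurable_coe _ hS).inv.mul
      (Kernel.measurable_coe _ (hS.inter (M.measurable_X t hB)))

lemma MarkovFamily.condP_univ_le (M : MarkovFamily I E Ω) (A : I → Set E) (x : E) (u : I) :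
    M.condP A x u Set.univ ≤ 1 := prob_le_one (μ := (M.P x)[|M.survive A u])

instance (M : MarkovFamily I E Ω) (A : I → Set E) (x : E) (u : I) :
    IsFiniteMeasure (M.condP A x u) :=
  inferInstanceAs (IsFiniteMeasure ((M.P x)[|M.survive A u]))

instance (M : MarkovFamily I E Ω) (A : I → Set E) (x : E) (t u : I) :
    IsFiniteMeasure (M.condLaw A x t u) :=
  inferInstanceAs (IsFiniteMeasure ((M.condP A x u).map (M.X t)))

instance (M : MarkovFamily I E Ω) (A : I → Set E) (t u : I)
    (hS : MeasurableSet (M.survive A u)) : IsFiniteKernel (M.condLawKernel A t u hS) :=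
  ⟨1, ENNReal.one_lt_top, fun x => by
    change M.condLaw A x t u Set.univ ≤ 1
    rw [MarkovFamily.condLaw, Measure.map_apply (M.measurable_X t) MeasurableSet.univ]
    exact M.condP_univ_le A x u⟩

namespace UniformCV

variable {M : MarkovFamily I E Ω} {A : I → Set E} {ν : I → Measure E} {t₀ : I} {c₁ c₂ : ℝ≥0}

/-- The conditions are stable under time shifts with the same constants, so estimates are proved
from time `0` only and then applied to `shiftBoundary A s`. -/
protected lemma shift (h : UniformCV M A ν t₀ c₁ c₂) (s : I) :
    UniformCV M (shiftBoundary A s) (fun r => ν (s + r)) t₀ c₁ c₂ where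
  measurable_boundary t := h.measurable_boundary _
  measurable_survive r t := by
    rw [shiftBoundary_shiftBoundary]; exact h.measurable_survive _ _
  survival_pos r t x hx := by
    rw [shiftBoundary_shiftBoundary]; exact h.survival_pos _ _ x hx
  c₁_pos := h.c₁_pos
  c₂_pos := h.c₂_pos
  isLawOn r := h.isLawOn _
  minorized r x hx := by
    rw [shiftBoundary_shiftBoundary, ← add_assoc]; exact h.minorized _ x hx
  comparison r t x hx := by
    rw [shiftBoundary_shiftBoundary]; exact h.comparison _ _ x hx

lemma measurableSet_survive_filtration (h : UniformCV M A ν t₀ c₁ c₂) (t : I) :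
    MeasurableSet[M.filtration t] (M.survive A t) := by
  simpa [shiftBoundary_zero] using h.measurable_survive 0 t

lemma measurableSet_survive (h : UniformCV M A ν t₀ c₁ c₂) (t : I) :
    MeasurableSet (M.survive A t) :=
  M.filtration.le t _ (h.measurableSet_survive_filtration t)

lemma measure_survive_ne_zero (h : UniformCV M A ν t₀ c₁ c₂) {x : E} (hx : x ∈ (A 0)ᶜ) (t : I) :
    M.P x (M.survive A t) ≠ 0 := by
  simpa [shiftBoundary_zero] using (h.survival_pos 0 t x hx).ne'

lemma isProbabilityMeasure_condP (h : UniformCV M A ν t₀ c₁ c₂) {x : E} (hx : x ∈ (A 0)ᶜ) (u : I) :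
    IsProbabilityMeasure (M.condP A x u) :=
  cond_isProbabilityMeasure (h.measure_survive_ne_zero hx u)

lemma isProbabilityMeasure_condLaw (h : UniformCV M A ν t₀ c₁ c₂) {x : E} (hx : x ∈ (A 0)ᶜ)
    (t u : I) : IsProbabilityMeasure (M.condLaw A x t u) :=
  have := h.isProbabilityMeasure_condP hx u
  Measure.isProbabilityMeasure_map (M.measurable_X t).aemeasurable

lemma condLaw_compl (h : UniformCV M A ν t₀ c₁ c₂) (x : E) {t u : I} (htu : t ≤ u) :
    M.condLaw A x t u (A t)ᶜᶜ = 0 := by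
  rw [compl_compl, MarkovFamily.condLaw,
    Measure.map_apply (M.measurable_X t) (h.measurable_boundary t), MarkovFamily.condP,
    cond_apply (h.measurableSet_survive u)]
  have : M.survive A u ∩ M.X t ⁻¹' A t = ∅ := by
    ext ω
    simp only [Set.mem_inter_iff, Set.mem_preimage, Set.mem_empty_iff_false, iff_false, not_and]
    exact fun hω => M.notMem_of_mem_survive hω htu
  simp [this]

lemma nonempty_compl (h : UniformCV M A ν t₀ c₁ c₂) : (A 0)ᶜ.Nonempty :=
  have := (h.isLawOn 0).1
  nonempty_of_measure_compl_eq_zero (h.isLawOn 0).2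

lemma lintegral_survive_le_one (h : UniformCV M A ν t₀ c₁ c₂) (s : I) (S : Set Ω) :
    ∫⁻ y, M.P y S ∂(ν s) ≤ 1 := by
  have := (h.isLawOn s).1
  calc ∫⁻ y, M.P y S ∂(ν s) ≤ ∫⁻ _, 1 ∂(ν s) := lintegral_mono fun _ => prob_le_one
    _ = 1 := by simp

/-- The comparison inequality at any point of `E_s` bounds this integral below by a positive number.
It serves as a normalising constant. -/
lemma lintegral_survive_ne_zero (h : UniformCV M A ν t₀ c₁ c₂) (s u : I) :
    ∫⁻ y, M.P y (M.survive (shiftBoundary A s) u) ∂(ν s) ≠ 0 := by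
  obtain ⟨y, hy⟩ := (h.shift s).nonempty_compl
  rw [shiftBoundary_apply_zero] at hy
  have h1 := h.comparison s u y hy
  have h2 : 0 < (c₂ : ℝ≥0∞) * M.P y (M.survive (shiftBoundary A s) u) :=
    ENNReal.mul_pos (by simpa using h.c₂_pos.ne') (h.survival_pos s u y hy).ne'
  exact (h2.trans_le h1).ne'

variable [IsOrderedCancelAddMonoid I] [CanonicallyOrderedAdd I]

/-- The Markov property of the conditioned process. -/
lemma condP_inter_shift (h : UniformCV M A ν t₀ c₁ c₂) (x : E) (t v : I) {F Λ : Set Ω}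
    (hF : MeasurableSet[M.filtration t] F) (hΛ : MeasurableSet[⨆ r, M.filtration r] Λ) :
    M.condP A x (t + v) (F ∩ M.shift t ⁻¹' Λ) =
      ∫⁻ ω in F, M.condP (shiftBoundary A t) (M.X t ω) v Λ ∂(M.condP A x (t + v)) := by
  have hS := h.measurableSet_survive (t + v)
  have hS' := (h.shift t).measurableSet_survive v
  have hSS' := M.filtration_le_iSup v _ ((h.shift t).measurableSet_survive_filtration v)
  have hFS : MeasurableSet[M.filtration t] (F ∩ M.survive A t) :=
    hF.inter (h.measurableSet_survive_filtration t)
  have hmeas : Measurable fun y => M.condP (shiftBoundary A t) y v Λ := by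
    have : (fun y => M.condP (shiftBoundary A t) y v Λ) = fun y =>
        (M.P y (M.survive (shiftBoundary A t) v))⁻¹ *
          M.P y (M.survive (shiftBoundary A t) v ∩ Λ) := by
      funext y
      rw [MarkovFamily.condP, cond_apply hS']
    rw [this]
    exact (Kernel.measurable_coe _ hS').inv.mul
      (Kernel.measurable_coe _ (hS'.inter (M.iSup_filtration_le _ hΛ)))
  have hdec := M.survive_add A t v
  rw [MarkovFamily.condP, cond_apply hS, ProbabilityTheory.cond, Measure.restrict_smul,
    lintegral_smul_measure, Measure.restrict_restrict (M.filtration.le t _ hF), hdec]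
  have e1 : M.survive A t ∩ M.shift t ⁻¹' M.survive (shiftBoundary A t) v ∩
      (F ∩ M.shift t ⁻¹' Λ) =
      F ∩ M.survive A t ∩ M.shift t ⁻¹' (M.survive (shiftBoundary A t) v ∩ Λ) := by
    ext ω; simp only [Set.mem_inter_iff, Set.mem_preimage]; tauto
  have hmk := M.markov_lintegral x t hFS (hSS'.inter hΛ) (g := fun _ => 1) measurable_const
  simp only [lintegral_const, Measure.restrict_apply_univ, one_mul] at hmk
  rw [e1, ← Set.inter_assoc, M.markov_lintegral x t hFS hSS' hmeas, hmk, smul_eq_mul]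
  congr 1
  refine lintegral_congr fun ω => ?_
  rw [MarkovFamily.condP, cond_mul_eq_inter hS']

/-- The restriction to a past event `F` is kept because the existence of the `Q`-process concerns
events of the whole trajectory, not only marginals. -/
lemma restrict_condP_map_eq_bind (h : UniformCV M A ν t₀ c₁ c₂) (x : E) (t u v : I) {F : Set Ω}
    (hF : MeasurableSet[M.filtration t] F) :
    ((M.condP A x (t + v)).restrict F).map (M.X (t + u)) =
      (((M.condP A x (t + v)).restrict F).map (M.X t)).bind
        (M.condLawKernel (shiftBoundary A t) u v ((h.shift t).measurableSet_survive v)) := by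
  ext B hB
  have hΛ : MeasurableSet[⨆ r, M.filtration r] (M.X u ⁻¹' B) :=
    M.filtration_le_iSup u _ (M.measurable_X_filtration le_rfl hB)
  rw [Measure.bind_apply hB (Kernel.aemeasurable _),
    lintegral_map (Kernel.measurable_coe _ hB) (M.measurable_X t),
    Measure.map_apply (M.measurable_X _) hB, Measure.restrict_apply (M.measurable_X _ hB)]
  have e1 : M.X (t + u) ⁻¹' B ∩ F = F ∩ M.shift t ⁻¹' (M.X u ⁻¹' B) := by
    ext ω; simp [M.X_shift, and_comm]
  rw [e1, h.condP_inter_shift x t v hF hΛ]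
  refine lintegral_congr fun ω => ?_
  change _ = M.condLaw (shiftBoundary A t) (M.X t ω) u v B
  rw [MarkovFamily.condLaw, Measure.map_apply (M.measurable_X u) hB]

lemma condLaw_eq_bind (h : UniformCV M A ν t₀ c₁ c₂) (x : E) (t u v : I) :
    M.condLaw A x (t + u) (t + v) = (M.condLaw A x t (t + v)).bind
      (M.condLawKernel (shiftBoundary A t) u v ((h.shift t).measurableSet_survive v)) := by
  have := h.restrict_condP_map_eq_bind x t u v (F := Set.univ) MeasurableSet.univ
  rwa [Measure.restrict_univ] at this

lemma integral_condLaw (h : UniformCV M A ν t₀ c₁ c₂) (x : E) (t u v : I) {f : E → ℝ}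
    (hf : Integrable f (M.condLaw A x (t + u) (t + v))) :
    ∫ y, f y ∂(M.condLaw A x (t + u) (t + v)) =
      ∫ y, ∫ z, f z ∂(M.condLaw (shiftBoundary A t) y u v) ∂(M.condLaw A x t (t + v)) := by
  rw [h.condLaw_eq_bind] at hf ⊢
  exact integral_bind_kernel hf

lemma measure_survive_inter (h : UniformCV M A ν t₀ c₁ c₂) {x : E} (hx : x ∈ (A 0)ᶜ) (t u : I)
    {F : Set Ω} (hF : MeasurableSet[M.filtration t] F) :
    M.P x (M.survive A (t + u) ∩ F) = M.P x (M.survive A t) *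
      ∫⁻ ω in F, M.P (M.X t ω) (M.survive (shiftBoundary A t) u) ∂(M.condP A x t) := by
  have hSS' := M.filtration_le_iSup u _ ((h.shift t).measurableSet_survive_filtration u)
  have hFS : MeasurableSet[M.filtration t] (F ∩ M.survive A t) :=
    hF.inter (h.measurableSet_survive_filtration t)
  have hmk := M.markov_lintegral x t hFS hSS' (g := fun _ => 1) measurable_const
  simp only [lintegral_const, Measure.restrict_apply_univ, one_mul] at hmk
  have e1 : M.survive A (t + u) ∩ F =
      F ∩ M.survive A t ∩ M.shift t ⁻¹' M.survive (shiftBoundary A t) u := by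
    rw [M.survive_add]; ext ω; simp only [Set.mem_inter_iff, Set.mem_preimage]; tauto
  rw [e1, hmk, MarkovFamily.condP, ProbabilityTheory.cond, Measure.restrict_smul,
    lintegral_smul_measure, Measure.restrict_restrict (M.filtration.le t _ hF), smul_eq_mul,
    ← mul_assoc, ENNReal.mul_inv_cancel (h.measure_survive_ne_zero hx t) (measure_ne_top _ _),
    one_mul]

/-- The laws at time `t₀` of the process conditioned to survive have a common part. -/
lemma exists_minorizing (h : UniformCV M A ν t₀ c₁ c₂) (T : I) :
    ∃ m : Measure E, IsProbabilityMeasure m ∧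
      ∀ x ∈ (A 0)ᶜ, (c₁ * c₂) • m ≤ M.condLaw A x t₀ (t₀ + T) := by
  set g : E → ℝ≥0∞ := fun y => M.P y (M.survive (shiftBoundary A t₀) T) with hg
  have hS' := (h.shift t₀).measurableSet_survive T
  have hgm : Measurable g := Kernel.measurable_coe _ hS'
  set N := ∫⁻ y, g y ∂(ν t₀) with hN
  have hN0 : N ≠ 0 := h.lintegral_survive_ne_zero t₀ T
  have hNtop : N ≠ ⊤ := ne_top_of_le_ne_top ENNReal.one_ne_top (h.lintegral_survive_le_one t₀ _)
  -- The common part is `ν t₀` reweighted by the probability of surviving the remaining time `T`. In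
  -- the ratio defining `condLaw`, the minorization bounds the numerator below and yields `c₁`,
  -- while the comparison bounds the denominator above and yields `c₂`.
  refine ⟨N⁻¹ • (ν t₀).withDensity g, ⟨?_⟩, fun x hx => ?_⟩
  · rw [Measure.smul_apply, withDensity_apply _ MeasurableSet.univ, Measure.restrict_univ,
      smul_eq_mul, ENNReal.inv_mul_cancel hN0 hNtop]
  refine Measure.le_iff.2 fun B hB => ?_
  have hq0 := h.measure_survive_ne_zero hx (t₀ + T)
  have hXB := M.measurable_X_filtration (le_refl t₀) hB
  have hmin : c₁ • ν t₀ ≤ M.condLaw A x t₀ t₀ := by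
    simpa [shiftBoundary_zero] using h.minorized 0 x hx
  have hnum : M.P x (M.survive A (t₀ + T) ∩ M.X t₀ ⁻¹' B) =
      M.P x (M.survive A t₀) * ∫⁻ y in B, g y ∂(M.condLaw A x t₀ t₀) := by
    rw [h.measure_survive_inter hx t₀ T hXB, MarkovFamily.condLaw,
      setLIntegral_map hB hgm (M.measurable_X t₀)]
  have hden : M.P x (M.survive A (t₀ + T)) * c₂ ≤ M.P x (M.survive A t₀) * N := by
    have := h.isProbabilityMeasure_condP hx t₀
    have := h.measure_survive_inter hx t₀ T (F := Set.univ) MeasurableSet.univ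
    rw [Set.inter_univ, Measure.restrict_univ] at this
    rw [this, mul_assoc]
    refine mul_le_mul_right ?_ _
    rw [← lintegral_mul_const _ (show Measurable fun ω => M.P (M.X t₀ ω)
      (M.survive (shiftBoundary A t₀) T) from hgm.comp (M.measurable_X t₀))]
    have hae : ∀ᵐ ω ∂(M.condP A x t₀), ω ∈ M.survive A t₀ :=
      ae_cond_mem (h.measurableSet_survive t₀)
    calc ∫⁻ ω, g (M.X t₀ ω) * c₂ ∂(M.condP A x t₀) ≤ ∫⁻ _, N ∂(M.condP A x t₀) := by
          refine lintegral_mono_ae ?_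
          filter_upwards [hae] with ω hω
          rw [mul_comm]
          exact h.comparison t₀ T _ (M.notMem_of_mem_survive hω le_rfl)
      _ = N := by simp
  have hint : c₁ * ∫⁻ y in B, g y ∂(ν t₀) ≤ ∫⁻ y in B, g y ∂(M.condLaw A x t₀ t₀) := by
    rw [← smul_eq_mul, ← lintegral_smul_measure, ← Measure.restrict_smul]
    exact lintegral_mono' (Measure.restrict_mono le_rfl hmin) le_rfl
  rw [MarkovFamily.condLaw, Measure.map_apply (M.measurable_X t₀) hB, MarkovFamily.condP,
    cond_apply (h.measurableSet_survive _), hnum, Measure.smul_apply, Measure.smul_apply,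
    withDensity_apply _ hB, ENNReal.smul_def, smul_eq_mul, smul_eq_mul, ENNReal.coe_mul]
  set p := M.P x (M.survive A t₀)
  set q := M.P x (M.survive A (t₀ + T))
  have hqtop : q ≠ ⊤ := measure_ne_top _ _
  rw [mul_comm q⁻¹, ← div_eq_mul_inv, ENNReal.le_div_iff_mul_le (Or.inl hq0) (Or.inl hqtop)]
  calc (c₁ : ℝ≥0∞) * c₂ * (N⁻¹ * ∫⁻ y in B, g y ∂(ν t₀)) * q
      = (q * c₂) * N⁻¹ * (c₁ * ∫⁻ y in B, g y ∂(ν t₀)) := by ring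
    _ ≤ (p * N) * N⁻¹ * ∫⁻ y in B, g y ∂(M.condLaw A x t₀ t₀) := by gcongr
    _ = p * ∫⁻ y in B, g y ∂(M.condLaw A x t₀ t₀) := by
      rw [mul_assoc p, ENNReal.mul_inv_cancel hN0 hNtop, mul_one]

lemma mul_le_one (h : UniformCV M A ν t₀ c₁ c₂) : c₁ * c₂ ≤ 1 := by
  obtain ⟨m, hm, hle⟩ := h.exists_minorizing t₀
  obtain ⟨x, hx⟩ := h.nonempty_compl
  have := h.isProbabilityMeasure_condLaw hx t₀ (t₀ + t₀)
  have := hle x hx Set.univ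
  rw [Measure.smul_apply, measure_univ, measure_univ, ENNReal.smul_def, smul_eq_mul,
    mul_one] at this
  exact_mod_cast this

/-- The oscillation of `x ↦ E_x[f(X_t) | τ_A > t + T]` decays exponentially in `t`. -/
lemma integral_condLaw_sub_le (n : ℕ) {A : I → Set E} {ν : I → Measure E}
    (h : UniformCV M A ν t₀ c₁ c₂) {t : I} (hn : n • t₀ ≤ t) (T : I) {f : E → ℝ}
    (hfm : Measurable f) {a : ℝ} (hf : ∀ x ∈ (A t)ᶜ, ∀ y ∈ (A t)ᶜ, f x - f y ≤ a)
    {x y : E} (hx : x ∈ (A 0)ᶜ) (hy : y ∈ (A 0)ᶜ) :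
    ∫ z, f z ∂(M.condLaw A x t (t + T)) - ∫ z, f z ∂(M.condLaw A y t (t + T)) ≤
      (1 - (c₁ * c₂ : ℝ≥0)) ^ n * a := by
  induction n generalizing A ν t x y with
  | zero =>
    have := h.isProbabilityMeasure_condLaw hx t (t + T)
    have := h.isProbabilityMeasure_condLaw hy t (t + T)
    rw [pow_zero, one_mul]
    exact integral_sub_integral_le_of_sub_le (h.condLaw_compl x le_self_add)
      (h.condLaw_compl y le_self_add) hfm hf
  | succ n ih =>
    rw [succ_nsmul'] at hn
    obtain ⟨d, rfl⟩ := le_iff_exists_add.1 (le_self_add.trans hn)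
    have hn' := le_of_add_le_add_left hn
    have hint : ∀ x ∈ (A 0)ᶜ, Integrable f (M.condLaw A x (t₀ + d) (t₀ + (d + T))) := by
      intro x hx
      have := h.isProbabilityMeasure_condLaw hx (t₀ + d) (t₀ + (d + T))
      refine integrable_of_sub_le (h.condLaw_compl x ?_) hfm hf
      rw [← add_assoc]
      exact le_self_add
    -- The first block contributes one Doeblin factor, with horizon `d + T` left to survive. The
    -- inner integral is the same problem for the boundary shifted by `t₀`, hence the induction over
    -- all boundaries.
    rw [add_assoc, h.integral_condLaw x t₀ d (d + T) (hint x hx),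
      h.integral_condLaw y t₀ d (d + T) (hint y hy), pow_succ', mul_assoc]
    obtain ⟨m, hm, hle⟩ := h.exists_minorizing (d + T)
    have := h.isProbabilityMeasure_condLaw hx t₀ (t₀ + (d + T))
    have := h.isProbabilityMeasure_condLaw hy t₀ (t₀ + (d + T))
    refine integral_sub_integral_le_of_minorized (h.condLaw_compl x le_self_add)
      (h.condLaw_compl y le_self_add) (mul_pos h.c₁_pos h.c₂_pos) (hle x hx) (hle y hy) ?_ ?_
    · exact (hfm.stronglyMeasurable.integral_kernel (κ := M.condLawKernel (shiftBoundary A t₀) d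
        (d + T) ((h.shift t₀).measurableSet_survive _))).measurable
    · intro x' hx' y' hy'
      rw [← shiftBoundary_apply_zero A t₀] at hx' hy'
      exact ih (h.shift t₀) hn' hf hx' hy'

end UniformCV

end Conditioned

/-- The exponential rate of convergence towards the `Q`-process. -/
noncomputable def rate (c : ℝ≥0) (n : ℕ) : ℝ := 2 * (1 - (c : ℝ)) ^ n / c

lemma tendsto_rate {c : ℝ≥0} (hc : 0 < c) (hc1 : c ≤ 1) : Tendsto (rate c) atTop (𝓝 0) := by
  have hc1' : (c : ℝ) ≤ 1 := by exact_mod_cast hc1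
  have hc' : (0 : ℝ) < c := by exact_mod_cast hc
  have := tendsto_pow_atTop_nhds_zero_of_lt_one (r := 1 - (c : ℝ)) (by linarith) (by linarith)
  change Tendsto (fun n => 2 * (1 - (c : ℝ)) ^ n / c) atTop (𝓝 0)
  simpa using (this.const_mul 2).div_const (c : ℝ)

lemma exists_rate_lt {c : ℝ≥0} (hc : 0 < c) (hc1 : c ≤ 1) {ε : ℝ} (hε : 0 < ε) :
    ∃ n, rate c n < ε :=
  ((tendsto_rate hc hc1).eventually (gt_mem_nhds hε)).exists

lemma pow_le_rate {c : ℝ≥0} (hc : 0 < c) (hc1 : c ≤ 1) (n : ℕ) :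
    (1 - (c : ℝ)) ^ n ≤ rate c n := by
  have hc1' : (c : ℝ) ≤ 1 := by exact_mod_cast hc1
  have hc' : (0 : ℝ) < c := by exact_mod_cast hc
  rw [rate, le_div_iff₀ hc']
  have := pow_nonneg (sub_nonneg.2 hc1') n
  nlinarith

/-! ### Existence of the `Q`-process. -/

section TrajectoryLimit

variable {I E Ω : Type*} [AddCommMonoid I] [ConditionallyCompleteLinearOrderBot I]
  [MeasurableSpace I] [MeasurableSpace E] [MeasurableSpace Ω]

/-- A version of the `Q`-process that depends measurably on the starting point, with a uniform
rate of convergence. -/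
structure UniformQProcess (M : MarkovFamily I E Ω) (A : I → Set E) (t₀ : I) (c : ℝ≥0)
    (Q : (s t : I) → E → Measure (Set.Iic t → E)) : Prop where
  measurable : ∀ s t, Measurable (Q s t)
  univ_le_one : ∀ s t x, Q s t x Set.univ ≤ 1
  isProbabilityMeasure : ∀ s t, ∀ x ∈ (A s)ᶜ, IsProbabilityMeasure (Q s t x)
  close : ∀ s t, ∀ x ∈ (A s)ᶜ, ∀ n T, (n + 1) • t₀ ≤ T →
    UniformlyClose ((M.condP (shiftBoundary A s) x (t + T)).map (M.traj t)) (Q s t x) (rate c n)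

lemma UniformQProcess.isQProcess {M : MarkovFamily I E Ω} {A : I → Set E} {t₀ : I} {c : ℝ≥0}
    {Q : (s t : I) → E → Measure (Set.Iic t → E)} (hQ : UniformQProcess M A t₀ c Q) (hc : 0 < c)
    (hc1 : c ≤ 1) : IsQProcess M A Q := by
  intro s t x hx
  have := hQ.isProbabilityMeasure s t x hx
  refine ⟨this, fun B hB => ?_⟩
  rw [← ENNReal.tendsto_toReal_iff (fun _ => measure_ne_top _ _) (measure_ne_top _ _),
    Metric.tendsto_nhds]
  intro ε hε
  obtain ⟨n, hn⟩ := exists_rate_lt hc hc1 hε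
  filter_upwards [eventually_ge_atTop ((n + 1) • t₀)] with T hT
  exact (hQ.close s t x hx n T hT B hB).trans_lt hn

namespace UniformCV

variable {M : MarkovFamily I E Ω} {A : I → Set E} {ν : I → Measure E} {t₀ : I} {c₁ c₂ : ℝ≥0}
  [IsOrderedCancelAddMonoid I] [CanonicallyOrderedAdd I]

/-- The minorization is restarted at time `t - t₀`: the law at `t` is a mixture of laws that all
dominate `c₁ • ν t`. -/
lemma smul_le_condLaw (h : UniformCV M A ν t₀ c₁ c₂) {x : E} (hx : x ∈ (A 0)ᶜ) {t : I}
    (ht : t₀ ≤ t) : c₁ • ν t ≤ M.condLaw A x t t := by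
  obtain ⟨r, rfl⟩ := le_iff_exists_add'.1 ht
  refine Measure.le_iff.2 fun B hB => ?_
  have := h.isProbabilityMeasure_condLaw hx r (r + t₀)
  have hS : ∀ᵐ y ∂(M.condLaw A x r (r + t₀)), y ∈ (A r)ᶜ :=
    ae_iff.2 (h.condLaw_compl x le_self_add)
  rw [h.condLaw_eq_bind x r t₀ t₀, Measure.bind_apply hB (Kernel.aemeasurable _)]
  calc (c₁ • ν (r + t₀)) B = ∫⁻ _, (c₁ • ν (r + t₀)) B ∂(M.condLaw A x r (r + t₀)) := by simp
    _ ≤ _ := lintegral_mono_ae (by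
      filter_upwards [hS] with y hy
      exact h.minorized r y hy B)

/-- Surviving `u` longer reweights paths by `g (X_{t+T})`, whose conditional expectation given the
past up to `t` is `Φ (X_t)`. By contraction, `Φ` oscillates by at most `(1 - c₁ * c₂) ^ n * (H /
c₂)`, while its mean is at least `c₁ * H`. The relative oscillation bounds the change of every past
event, uniformly in `u`. -/
lemma abs_condP_sub_le (h : UniformCV M A ν t₀ c₁ c₂) {x : E} (hx : x ∈ (A 0)ᶜ) (t u : I) {T : I}
    {n : ℕ} (hn : n • t₀ ≤ T) (hT : t₀ ≤ T) {F : Set Ω} (hF : MeasurableSet[M.filtration t] F) :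
    |(M.condP A x (t + T + u)).real F - (M.condP A x (t + T)).real F| ≤
      (1 - (c₁ * c₂ : ℝ≥0)) ^ n / (c₁ * c₂ : ℝ≥0) := by
  have hF' := M.filtration.le t _ hF
  set p := M.condP A x (t + T)
  have hprob : IsProbabilityMeasure p := h.isProbabilityMeasure_condP hx _
  set S' := M.survive (shiftBoundary A (t + T)) u
  have hS' : MeasurableSet S' := (h.shift (t + T)).measurableSet_survive u
  set g : E → ℝ := fun y => (M.P y).real S' with hg
  have hgm : Measurable g := (Kernel.measurable_coe _ hS').ennreal_toReal
  have hg0 : ∀ y, 0 ≤ g y := fun y => measureReal_nonneg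
  have hg1 : ∀ y, g y ≤ 1 := fun y => measureReal_le_one
  have hgint : ∀ (ρ : Measure E) [IsFiniteMeasure ρ], Integrable g ρ := fun ρ _ =>
    Integrable.of_bound hgm.aestronglyMeasurable 1
      (Eventually.of_forall fun y => by rw [Real.norm_of_nonneg (hg0 y)]; exact hg1 y)
  have := (h.isLawOn (t + T)).1
  set H := ∫ y, g y ∂(ν (t + T)) with hH
  have hHl : ∫⁻ y, M.P y S' ∂(ν (t + T)) = ENNReal.ofReal H := by
    rw [hH, ofReal_integral_eq_lintegral_ofReal (hgint _) (Eventually.of_forall hg0)]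
    simp [hg]
  have hHpos : 0 < H := by
    rw [← ENNReal.ofReal_pos, ← hHl, pos_iff_ne_zero]
    exact h.lintegral_survive_ne_zero (t + T) u
  have hc₁ : (0 : ℝ) < c₁ := by exact_mod_cast h.c₁_pos
  have hc₂ : (0 : ℝ) < c₂ := by exact_mod_cast h.c₂_pos
  have hc1 : ((c₁ * c₂ : ℝ≥0) : ℝ) ≤ 1 := by exact_mod_cast h.mul_le_one
  have hgH : ∀ y ∈ (A (t + T))ᶜ, g y ≤ H / c₂ := by
    intro y hy
    have := ENNReal.toReal_mono (by rw [hHl]; exact ENNReal.ofReal_ne_top)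
      (h.comparison (t + T) u y hy)
    rw [hHl, ENNReal.toReal_ofReal hHpos.le, ENNReal.toReal_mul, ENNReal.coe_toReal] at this
    rw [le_div_iff₀ hc₂, mul_comm]
    exact this
  set κ := M.condLawKernel (shiftBoundary A t) T T ((h.shift t).measurableSet_survive T)
  set Φ : E → ℝ := fun y => ∫ z, g z ∂(κ y)
  have hΦm : Measurable Φ := (hgm.stronglyMeasurable.integral_kernel (κ := κ)).measurable
  set a := (1 - ((c₁ * c₂ : ℝ≥0) : ℝ)) ^ n * (H / c₂) with ha
  have ha0 : 0 ≤ a := mul_nonneg (pow_nonneg (by linarith) n) (by positivity)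
  have hΦosc : ∀ y ∈ (A t)ᶜ, ∀ z ∈ (A t)ᶜ, Φ y - Φ z ≤ a := by
    intro y hy z hz
    rw [← shiftBoundary_apply_zero A t] at hy hz
    have := integral_condLaw_sub_le n (h.shift t) hn 0 hgm (a := H / c₂)
      (fun y hy z hz => by linarith [hgH y hy, hg0 z]) hy hz
    rwa [add_zero] at this
  have hswap : ∀ G, MeasurableSet[M.filtration t] G →
      ∫ ω in G, g (M.X (t + T) ω) ∂p = ∫ ω in G, Φ (M.X t ω) ∂p := by
    intro G hG
    have hbind := h.restrict_condP_map_eq_bind x t T T hG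
    rw [← integral_map (M.measurable_X _).aemeasurable hgm.aestronglyMeasurable,
      ← integral_map (M.measurable_X _).aemeasurable hΦm.aestronglyMeasurable, hbind]
    exact integral_bind_kernel (hbind ▸ hgint _)
  set N := ∫ ω, g (M.X (t + T) ω) ∂p with hN
  have hNΦ : N = ∫ y, Φ y ∂(M.condLaw A x t (t + T)) := by
    have := hswap Set.univ MeasurableSet.univ
    rw [setIntegral_univ, setIntegral_univ] at this
    rw [hN, this, MarkovFamily.condLaw, integral_map (M.measurable_X _).aemeasurable
      hΦm.aestronglyMeasurable]
  have hlaw := h.isProbabilityMeasure_condLaw hx t (t + T)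
  have hcarr := h.condLaw_compl x (le_self_add (a := t) (b := T))
  have hΦN : ∀ᵐ ω ∂p, |Φ (M.X t ω) - N| ≤ a := by
    have hS : ∀ᵐ ω ∂p, ω ∈ M.survive A (t + T) := ae_cond_mem (h.measurableSet_survive _)
    filter_upwards [hS] with ω hω
    rw [hNΦ]
    exact integral_sub_le_of_sub_le hcarr hΦm hΦosc (M.notMem_of_mem_survive hω le_self_add)
  have hΦint : Integrable (fun ω => Φ (M.X t ω)) p :=
    (integrable_of_sub_le hcarr hΦm hΦosc).comp_measurable (M.measurable_X t)
  have hnum : |∫ ω in F, g (M.X (t + T) ω) ∂p - p.real F * N| ≤ a := by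
    have h1 : ∫ ω in F, g (M.X (t + T) ω) ∂p - p.real F * N =
        ∫ ω in F, (Φ (M.X t ω) - N) ∂p := by
      rw [hswap F hF, integral_sub hΦint.integrableOn (integrable_const _), setIntegral_const,
        smul_eq_mul]
    rw [h1]
    have h2 := norm_setIntegral_le_of_norm_le_const_ae' (μ := p) (s := F)
      (f := fun ω => Φ (M.X t ω) - N) (C := a) (measure_lt_top _ _)
      (hΦN.mono fun ω hω _ => hω)
    exact h2.trans (mul_le_of_le_one_right ha0 measureReal_le_one)
  -- Here `t₀ ≤ T` is needed: a full block before `t + T` makes the law there dominate `c₁ • ν (t +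
  -- T)`.
  have hNlow : c₁ * H ≤ N := by
    have hle := h.smul_le_condLaw hx (hT.trans (le_add_self (a := T) (b := t)))
    have := integral_mono_measure hle (f := g) (Eventually.of_forall hg0) (hgint _)
    rwa [integral_smul_nnreal_measure, NNReal.smul_def, smul_eq_mul, MarkovFamily.condLaw,
      integral_map (M.measurable_X _).aemeasurable hgm.aestronglyMeasurable] at this
  have hNpos : 0 < N := lt_of_lt_of_le (by positivity) hNlow
  have hratio : (M.condP A x (t + T + u)).real F = (∫ ω in F, g (M.X (t + T) ω) ∂p) / N := by
    have hint : ∀ G, MeasurableSet G →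
        (∫⁻ ω in G, M.P (M.X (t + T) ω) S' ∂p).toReal = ∫ ω in G, g (M.X (t + T) ω) ∂p := by
      intro G hG
      exact (integral_toReal ((Kernel.measurable_coe _ hS').comp (M.measurable_X _)).aemeasurable
        (Eventually.of_forall fun _ => measure_lt_top _ _)).symm
    have hFT := M.filtration.mono (le_self_add (a := t) (b := T)) _ hF
    have e1 := congrArg ENNReal.toReal (h.measure_survive_inter hx (t + T) u hFT)
    have e2 := congrArg ENNReal.toReal
      (h.measure_survive_inter hx (t + T) u (F := Set.univ) MeasurableSet.univ)
    rw [ENNReal.toReal_mul, hint _ hF'] at e1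
    rw [ENNReal.toReal_mul, hint _ MeasurableSet.univ, setIntegral_univ, Set.inter_univ, ← hN] at e2
    have hs : (M.P x (M.survive A (t + T))).toReal ≠ 0 :=
      (ENNReal.toReal_pos (h.measure_survive_ne_zero hx _) (measure_ne_top _ _)).ne'
    rw [measureReal_def, MarkovFamily.condP, cond_apply (h.measurableSet_survive _),
      ENNReal.toReal_mul, ENNReal.toReal_inv, e1, e2]
    field_simp
  rw [hratio, div_sub' hNpos.ne', abs_div, abs_of_pos hNpos, mul_comm N,
    div_le_iff₀ hNpos]
  refine hnum.trans ?_
  rw [ha]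
  calc (1 - ((c₁ * c₂ : ℝ≥0) : ℝ)) ^ n * (H / c₂)
      = (1 - ((c₁ * c₂ : ℝ≥0) : ℝ)) ^ n / (c₁ * c₂ : ℝ≥0) * (c₁ * H) := by
        push_cast; field_simp
    _ ≤ _ := by
        refine mul_le_mul_of_nonneg_left hNlow (div_nonneg (pow_nonneg (by linarith) n) ?_)
        positivity

lemma traj_close (h : UniformCV M A ν t₀ c₁ c₂) {x : E} (hx : x ∈ (A 0)ᶜ) (t : I) {T T' : I}
    (hTT' : T ≤ T') {n : ℕ} (hn : n • t₀ ≤ T) (hT : t₀ ≤ T) :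
    UniformlyClose ((M.condP A x (t + T')).map (M.traj t)) ((M.condP A x (t + T)).map (M.traj t))
      ((1 - (c₁ * c₂ : ℝ≥0)) ^ n / (c₁ * c₂ : ℝ≥0)) := by
  obtain ⟨u, rfl⟩ := le_iff_exists_add.1 hTT'
  intro B hB
  rw [map_measureReal_apply (M.measurable_traj t) hB,
    map_measureReal_apply (M.measurable_traj t) hB, ← add_assoc]
  exact h.abs_condP_sub_le hx t u hn hT (M.measurable_traj_filtration t hB)

lemma exists_traj_limit (h : UniformCV M A ν t₀ c₁ c₂) {x : E} (hx : x ∈ (A 0)ᶜ) (t : I) :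
    ∃ Q : Measure (Set.Iic t → E), IsProbabilityMeasure Q ∧ ∀ (n : ℕ) T, (n + 1) • t₀ ≤ T →
      UniformlyClose ((M.condP A x (t + T)).map (M.traj t)) Q (rate (c₁ * c₂) n) := by
  have hc := mul_pos h.c₁_pos h.c₂_pos
  set r : ℕ → ℝ := fun n => (1 - ((c₁ * c₂ : ℝ≥0) : ℝ)) ^ n / (c₁ * c₂ : ℝ≥0) with hr
  -- The factor `2` in `rate` pays for two comparisons: a general horizon with the reference horizon
  -- `(n + 1) • t₀`, and that one with the limit. The extra block in `n + 1` ensures `t₀ ≤ T` also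
  -- for `n = 0`.
  have hr2 : ∀ n, rate (c₁ * c₂) n = r n + r n := fun n => by
    rw [hr, rate, ← two_mul, mul_div_assoc]
  have hrlim : Tendsto r atTop (𝓝 0) := by
    have : r = fun n => rate (c₁ * c₂) n / 2 := funext fun n => by rw [hr2]; ring
    rw [this]
    simpa using (tendsto_rate hc h.mul_le_one).div_const 2
  have hle : ∀ n : ℕ, t₀ ≤ (n + 1) • t₀ := fun n => by
    rw [succ_nsmul]; exact le_add_self
  have hle' : ∀ n : ℕ, n • t₀ ≤ (n + 1) • t₀ := fun n => by
    rw [succ_nsmul]; exact le_self_add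
  have hmono : ∀ n m : ℕ, n ≤ m → (n + 1) • t₀ ≤ (m + 1) • t₀ := fun n m hnm => by
    obtain ⟨k, rfl⟩ := Nat.exists_eq_add_of_le hnm
    rw [add_right_comm, add_nsmul t₀ (n + 1) k]
    exact le_self_add
  have hprob : ∀ n : ℕ, IsProbabilityMeasure
      ((M.condP A x (t + (n + 1) • t₀)).map (M.traj t)) := fun n =>
    have := h.isProbabilityMeasure_condP hx (t + (n + 1) • t₀)
    Measure.isProbabilityMeasure_map (M.measurable_traj t).aemeasurable
  obtain ⟨Q, hQ, hclose⟩ := exists_limit_of_uniformlyClose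
    (fun n : ℕ => (M.condP A x (t + (n + 1) • t₀)).map (M.traj t)) hrlim
    (fun n m hnm => h.traj_close hx t (hmono n m hnm) (hle' n) (hle n))
  refine ⟨Q, hQ, fun n T hT => ?_⟩
  rw [hr2]
  exact (h.traj_close hx t hT (hle' n) (hle n)).trans (hclose n)

lemma exists_measurable_version (h : UniformCV M A ν t₀ c₁ c₂) :
    ∃ Q, UniformQProcess M A t₀ (c₁ * c₂) Q := by
  classical
  -- The value `0` on `A s` makes `Q s t` a pointwise limit of measurable maps on all of `E`, hence
  -- measurable in `x`; the mixtures in `qLaw` rely on this.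
  have hex : ∀ s t x, ∃ Q : Measure (Set.Iic t → E), (x ∈ A s → Q = 0) ∧ (x ∈ (A s)ᶜ →
      IsProbabilityMeasure Q ∧ ∀ (n : ℕ) T, (n + 1) • t₀ ≤ T →
      UniformlyClose ((M.condP (shiftBoundary A s) x (t + T)).map (M.traj t)) Q
        (rate (c₁ * c₂) n)) := by
    intro s t x
    by_cases hx : x ∈ A s
    · exact ⟨0, fun _ => rfl, fun h => absurd hx h⟩
    · obtain ⟨Q, hQ⟩ := (h.shift s).exists_traj_limit
        (by rw [shiftBoundary_apply_zero]; exact hx) t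
      exact ⟨Q, fun h => absurd h hx, fun _ => hQ⟩
  choose Q hQ0 hQ using hex
  refine ⟨Q, fun s t => ?_, fun s t x => ?_, fun s t x hx => (hQ s t x hx).1,
    fun s t x hx => (hQ s t x hx).2⟩
  swap
  · by_cases hx : x ∈ A s
    · simp [hQ0 s t x hx]
    · have := (hQ s t x hx).1
      exact prob_le_one
  refine Measure.measurable_of_measurable_coe _ fun B hB => ?_
  refine ENNReal.measurable_of_tendsto (f := fun (n : ℕ) => (A s)ᶜ.indicator fun x =>
    (M.condP (shiftBoundary A s) x (t + (n + 1) • t₀)).map (M.traj t) B) (fun n => ?_) ?_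
  · refine Measurable.indicator ?_ (h.measurable_boundary s).compl
    have hS := (h.shift s).measurableSet_survive (t + (n + 1) • t₀)
    have : (fun x => (M.condP (shiftBoundary A s) x (t + (n + 1) • t₀)).map (M.traj t) B) =
        fun x => (M.P x (M.survive (shiftBoundary A s) (t + (n + 1) • t₀)))⁻¹ *
          M.P x (M.survive (shiftBoundary A s) (t + (n + 1) • t₀) ∩ M.traj t ⁻¹' B) := by
      funext x
      rw [Measure.map_apply (M.measurable_traj t) hB, MarkovFamily.condP, cond_apply hS]
    rw [this]
    exact (Kernel.measurable_coe _ hS).inv.mul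
      (Kernel.measurable_coe _ (hS.inter (M.measurable_traj t hB)))
  · rw [tendsto_pi_nhds]
    intro x
    by_cases hx : x ∈ A s
    · simp [Set.indicator, hx, hQ0 s t x hx]
    · have hx' : x ∈ (A s)ᶜ := hx
      simp only [Set.indicator_of_mem hx']
      obtain ⟨hprob, hclose⟩ := hQ s t x hx'
      rw [← ENNReal.tendsto_toReal_iff (fun _ => measure_ne_top _ _) (measure_ne_top _ _),
        Metric.tendsto_nhds]
      intro ε hε
      filter_upwards [(tendsto_rate (mul_pos h.c₁_pos h.c₂_pos)
        h.mul_le_one).eventually (gt_mem_nhds hε)] with n hn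
      exact (hclose n _ le_rfl B hB).trans_lt hn

end UniformCV

end TrajectoryLimit

lemma UniformlyClose.of_forall_pos {α : Type*} [MeasurableSpace α] {μ μ' : Measure α} {δ : ℝ}
    (h : ∀ ε > 0, UniformlyClose μ μ' (δ + ε)) : UniformlyClose μ μ' δ := fun B hB =>
  le_of_forall_pos_le_add fun ε hε => h ε hε B hB

lemma UniformlyClose.eq {α : Type*} [MeasurableSpace α] {μ μ' : Measure α} [IsFiniteMeasure μ]
    [IsFiniteMeasure μ'] (h : ∀ ε > 0, UniformlyClose μ μ' ε) : μ = μ' := by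
  ext B hB
  have h0 : |μ.real B - μ'.real B| ≤ 0 := le_of_forall_pos_le_add fun ε hε => by
    rw [zero_add]; exact h ε hε B hB
  have h1 : μ.real B = μ'.real B := sub_eq_zero.1 (abs_nonpos_iff.1 h0)
  exact (ENNReal.toReal_eq_toReal_iff' (measure_ne_top _ _) (measure_ne_top _ _)).1 h1

/-! ### Marginals of the `Q`-process and loss of memory. -/

section EndLaw

variable {I E Ω : Type*} [AddCommMonoid I] [ConditionallyCompleteLinearOrderBot I]
  [MeasurableSpace I] [MeasurableSpace E] [MeasurableSpace Ω]

/-- `Q_{s,x}(X_{s+t} ∈ ·)`. -/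
noncomputable def endLaw (Q : (s t : I) → E → Measure (Set.Iic t → E)) (s t : I) (x : E) :
    Measure E :=
  (Q s t x).map fun w => w ⟨t, le_rfl⟩

namespace UniformQProcess

variable {M : MarkovFamily I E Ω} {A : I → Set E} {t₀ : I} {c : ℝ≥0}
    {Q : (s t : I) → E → Measure (Set.Iic t → E)}

lemma measurable_endLaw (hQ : UniformQProcess M A t₀ c Q) (s t : I) : Measurable (endLaw Q s t) :=
  (Measure.measurable_map _ (measurable_pi_apply _)).comp (hQ.measurable s t)

lemma endLaw_univ_le_one (hQ : UniformQProcess M A t₀ c Q) (s t : I) (x : E) :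
    endLaw Q s t x Set.univ ≤ 1 := by
  rw [endLaw, Measure.map_apply (measurable_pi_apply _) MeasurableSet.univ]
  exact hQ.univ_le_one s t x

lemma isFiniteMeasure_endLaw (hQ : UniformQProcess M A t₀ c Q) (s t : I) (x : E) :
    IsFiniteMeasure (endLaw Q s t x) :=
  ⟨(hQ.endLaw_univ_le_one s t x).trans_lt ENNReal.one_lt_top⟩

lemma endLaw_real_le_one (hQ : UniformQProcess M A t₀ c Q) (s t : I) (x : E) (B : Set E) :
    (endLaw Q s t x).real B ≤ 1 :=
  ENNReal.toReal_le_of_le_ofReal zero_le_one (by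
    simpa using (measure_mono (Set.subset_univ B)).trans (hQ.endLaw_univ_le_one s t x))

lemma measurable_endLaw_real (hQ : UniformQProcess M A t₀ c Q) (s t : I) {B : Set E}
    (hB : MeasurableSet B) : Measurable fun x => (endLaw Q s t x).real B :=
  ((Measure.measurable_coe hB).comp (hQ.measurable_endLaw s t)).ennreal_toReal

lemma isProbabilityMeasure_endLaw (hQ : UniformQProcess M A t₀ c Q) (s t : I) {x : E}
    (hx : x ∈ (A s)ᶜ) : IsProbabilityMeasure (endLaw Q s t x) :=
  have := hQ.isProbabilityMeasure s t x hx
  Measure.isProbabilityMeasure_map (measurable_pi_apply _).aemeasurable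

lemma condLaw_close (hQ : UniformQProcess M A t₀ c Q) (s t : I) {x : E} (hx : x ∈ (A s)ᶜ) {n : ℕ}
    {T : I} (hT : (n + 1) • t₀ ≤ T) :
    UniformlyClose (M.condLaw (shiftBoundary A s) x t (t + T)) (endLaw Q s t x) (rate c n) := by
  have := (hQ.close s t x hx n T hT).map (g := fun w => w ⟨t, le_rfl⟩) (measurable_pi_apply _)
  rwa [Measure.map_map (measurable_pi_apply _) (M.measurable_traj t)] at this

lemma isFiniteMeasure_qLaw (hQ : UniformQProcess M A t₀ c Q) (s t : I) (μ : Measure E)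
    [IsFiniteMeasure μ] : IsFiniteMeasure (qLaw Q s t μ) := by
  refine ⟨?_⟩
  have hb : qLaw Q s t μ = μ.bind (endLaw Q s t) := rfl
  rw [hb, Measure.bind_apply MeasurableSet.univ (hQ.measurable_endLaw s t).aemeasurable]
  refine (lintegral_mono fun x => hQ.endLaw_univ_le_one s t x).trans_lt ?_
  simp

lemma qLaw_real (hQ : UniformQProcess M A t₀ c Q) (s t : I) (μ : Measure E) {B : Set E}
    (hB : MeasurableSet B) : (qLaw Q s t μ).real B = ∫ x, (endLaw Q s t x).real B ∂μ := by
  have hb : qLaw Q s t μ = μ.bind (endLaw Q s t) := rfl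
  rw [measureReal_def, hb, Measure.bind_apply hB (hQ.measurable_endLaw s t).aemeasurable]
  refine (integral_toReal ((Measure.measurable_coe hB).comp
    (hQ.measurable_endLaw s t)).aemeasurable (Eventually.of_forall fun x => ?_)).symm
  have := hQ.isFiniteMeasure_endLaw s t x
  exact measure_lt_top _ _

lemma integrable_endLaw_real (hQ : UniformQProcess M A t₀ c Q) (s t : I) (μ : Measure E)
    [IsFiniteMeasure μ] {B : Set E} (hB : MeasurableSet B) :
    Integrable (fun x => (endLaw Q s t x).real B) μ :=
  Integrable.of_bound (hQ.measurable_endLaw_real s t hB).aestronglyMeasurable 1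
    (Eventually.of_forall fun x => by
      rw [Real.norm_of_nonneg measureReal_nonneg]; exact hQ.endLaw_real_le_one s t x B)

lemma qLaw_close (hQ : UniformQProcess M A t₀ c Q) {s t : I} {μ β : Measure E}
    (hμ : IsLawOn μ (A s)ᶜ) {ε : ℝ} (hε : ∀ x ∈ (A s)ᶜ, UniformlyClose (endLaw Q s t x) β ε) :
    UniformlyClose (qLaw Q s t μ) β ε := by
  intro B hB
  have := hμ.1
  have hS : ∀ᵐ x ∂μ, x ∈ (A s)ᶜ := ae_iff.2 hμ.2
  have h1 : (qLaw Q s t μ).real B - β.real B =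
      ∫ x, ((endLaw Q s t x).real B - β.real B) ∂μ := by
    rw [hQ.qLaw_real s t μ hB, integral_sub (hQ.integrable_endLaw_real s t μ hB)
      (integrable_const _)]
    simp
  rw [h1]
  have h2 := norm_integral_le_of_norm_le_const (μ := μ)
    (f := fun x => (endLaw Q s t x).real B - β.real B) (C := ε)
    (hS.mono fun x hx => hε x hx B hB)
  simpa using h2

end UniformQProcess

namespace UniformCV

variable {M : MarkovFamily I E Ω} {A : I → Set E} {ν : I → Measure E} {t₀ : I} {c₁ c₂ : ℝ≥0}
  [IsOrderedCancelAddMonoid I] [CanonicallyOrderedAdd I]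
  {Q : (s t : I) → E → Measure (Set.Iic t → E)}

lemma condLaw_real_eq_integral (h : UniformCV M A ν t₀ c₁ c₂) (x : E) (t u v : I) {B : Set E}
    (hB : MeasurableSet B) : (M.condLaw A x (t + u) (t + v)).real B =
      ∫ y, (M.condLaw (shiftBoundary A t) y u v).real B ∂(M.condLaw A x t (t + v)) := by
  have := h.integral_condLaw x t u v (f := B.indicator 1)
    ((integrable_const (1 : ℝ)).indicator hB)
  simpa only [integral_indicator_one hB] using this

/-- The law from `x` is a mixture, over the position at time `t`, of laws restarted at `t`. Each of
these is close to the one restarted from `y`, so the past before `t` is forgotten. -/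
lemma condLaw_close_of_start (h : UniformCV M A ν t₀ c₁ c₂) {x y : E} (hx : x ∈ (A 0)ᶜ) {t u : I}
    (hy : y ∈ (A t)ᶜ) {n : ℕ} (hn : n • t₀ ≤ u) (T : I) :
    UniformlyClose (M.condLaw A x (t + u) (t + (u + T)))
      (M.condLaw (shiftBoundary A t) y u (u + T)) ((1 - (c₁ * c₂ : ℝ≥0)) ^ n) := by
  intro B hB
  rw [abs_sub_comm, h.condLaw_real_eq_integral x t u (u + T) hB]
  have := h.isProbabilityMeasure_condLaw hx t (t + (u + T))
  have hS := (h.shift t).measurableSet_survive (u + T)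
  refine integral_sub_le_of_sub_le (h.condLaw_compl x le_self_add)
    (f := fun z => (M.condLaw (shiftBoundary A t) z u (u + T)).real B) ?_ (fun y hy z hz => ?_) hy
  · exact (Kernel.measurable_coe
      (M.condLawKernel (shiftBoundary A t) u (u + T) hS) hB).ennreal_toReal
  · rw [← shiftBoundary_apply_zero A t] at hy hz
    have hosc := integral_condLaw_sub_le n (h.shift t) hn T (f := B.indicator 1) (a := 1)
      (measurable_one.indicator hB) (fun y _ z _ => ?_) hy hz
    · simpa only [integral_indicator_one hB, mul_one] using hosc
    · have h1 : B.indicator (1 : E → ℝ) y ≤ 1 := Set.indicator_le_self' (by simp) y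
      have h2 : 0 ≤ B.indicator (1 : E → ℝ) z := Set.indicator_nonneg (by simp) z
      linarith

/-- The bound of `condLaw_close_of_start` does not depend on the horizon, so it survives letting the
horizon tend to infinity. -/
lemma endLaw_close (h : UniformCV M A ν t₀ c₁ c₂) (hQ : UniformQProcess M A t₀ (c₁ * c₂) Q)
    {s t u : I} {x y : E} (hx : x ∈ (A s)ᶜ) (hy : y ∈ (A (s + t))ᶜ) {n : ℕ} (hn : n • t₀ ≤ u) :
    UniformlyClose (endLaw Q s (t + u) x) (endLaw Q (s + t) u y) ((1 - (c₁ * c₂ : ℝ≥0)) ^ n) := by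
  refine UniformlyClose.of_forall_pos fun ε hε => ?_
  obtain ⟨k, hk⟩ := exists_rate_lt (mul_pos h.c₁_pos h.c₂_pos) h.mul_le_one (half_pos hε)
  set T := (k + 1) • t₀ with hT
  have h1 := hQ.condLaw_close s (t + u) hx (n := k) (T := T) le_rfl
  have h2 := hQ.condLaw_close (s + t) u hy (n := k) (T := T) le_rfl
  have h3 := (h.shift s).condLaw_close_of_start
    (by rw [shiftBoundary_apply_zero]; exact hx) (t := t) (y := y) hy hn T
  rw [shiftBoundary_shiftBoundary] at h3
  rw [add_assoc] at h1
  exact ((h1.symm.trans h3).trans h2).mono (by linarith)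

end UniformCV

end EndLaw

/-! ### Invariant law for a fixed absorbing set. -/

section FixedBoundary

variable {I E Ω : Type*} [AddCommMonoid I] [ConditionallyCompleteLinearOrderBot I]
  [MeasurableSpace I] [MeasurableSpace E] [MeasurableSpace Ω]
  {M : MarkovFamily I E Ω} {D : Set E} {ν : I → Measure E} {t₀ : I} {c₁ c₂ : ℝ≥0}
  {Q : (s t : I) → E → Measure (Set.Iic t → E)}

/-- The measures `Q s t x` may have been chosen separately for each `s`; for a constant boundary `Q
0` serves for every starting time, which turns `endLaw_close` into a time-homogeneous statement. -/
lemma UniformQProcess.const {c : ℝ≥0} (hQ : UniformQProcess M (fun _ => D) t₀ c Q) :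
    UniformQProcess M (fun _ => D) t₀ c (fun _ => Q 0) where
  measurable _ := hQ.measurable 0
  univ_le_one _ := hQ.univ_le_one 0
  isProbabilityMeasure _ := hQ.isProbabilityMeasure 0
  close _ := hQ.close 0

namespace UniformCV

variable [IsOrderedCancelAddMonoid I] [CanonicallyOrderedAdd I]

/-- The semigroup property of the `Q`-process of a fixed absorbing set. -/
lemma endLaw_add (h : UniformCV M (fun _ => D) ν t₀ c₁ c₂)
    (hQ : UniformQProcess M (fun _ => D) t₀ (c₁ * c₂) Q) {x : E} (hx : x ∈ Dᶜ) (t u : I)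
    {B : Set E} (hB : MeasurableSet B) : (endLaw Q 0 (t + u) x).real B =
      ∫ y, (endLaw Q 0 u y).real B ∂(endLaw Q 0 t x) := by
  rw [← sub_eq_zero, ← abs_nonpos_iff]
  refine le_of_forall_pos_le_add fun ε hε => ?_
  -- Three replacements of conditional laws by their limits: on the left side, in the outer measure
  -- and in the integrand.
  obtain ⟨k, hk⟩ := exists_rate_lt (mul_pos h.c₁_pos h.c₂_pos) h.mul_le_one
    (show 0 < ε / 3 by positivity)
  set T := (k + 1) • t₀ with hT
  have hTu : (k + 1) • t₀ ≤ u + T := le_add_self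
  have h1 := hQ.condLaw_close 0 (t + u) hx (n := k) (T := T) le_rfl B hB
  have h2 := hQ.condLaw_close 0 t hx hTu
  have := hQ.isFiniteMeasure_endLaw 0 t x
  have h3 := h2.abs_integral_sub_le_of_unit (hQ.measurable_endLaw_real 0 u hB)
    (fun y => measureReal_nonneg) (fun y => hQ.endLaw_real_le_one 0 u y B)
  have hS : ∀ᵐ y ∂(M.condLaw (fun _ => D) x t (t + (u + T))), y ∈ Dᶜ :=
    ae_iff.2 (h.condLaw_compl x le_self_add)
  have hprob := h.isProbabilityMeasure_condLaw hx t (t + (u + T))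
  have hSm := h.measurableSet_survive (u + T)
  have hint : Integrable (fun y => (M.condLaw (fun _ => D) y u (u + T)).real B)
      (M.condLaw (fun _ => D) x t (t + (u + T))) := by
    refine integrable_of_sub_le (h.condLaw_compl x le_self_add) (a := 1)
      (Kernel.measurable_coe (M.condLawKernel (fun _ => D) u (u + T) hSm) hB).ennreal_toReal
      (fun y hy z hz => ?_)
    have := h.isProbabilityMeasure_condLaw hy u (u + T)
    linarith [measureReal_le_one (μ := M.condLaw (fun _ => D) y u (u + T)) (s := B),
      measureReal_nonneg (μ := M.condLaw (fun _ => D) z u (u + T)) (s := B)]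
  have h4 : |(M.condLaw (fun _ => D) x (t + u) (t + (u + T))).real B -
      ∫ y, (endLaw Q 0 u y).real B ∂(M.condLaw (fun _ => D) x t (t + (u + T)))| ≤
      rate (c₁ * c₂) k := by
    rw [h.condLaw_real_eq_integral x t u (u + T) hB]
    change |∫ y, (M.condLaw (fun _ => D) y u (u + T)).real B ∂_ - _| ≤ _
    rw [← integral_sub hint (hQ.integrable_endLaw_real 0 u _ hB)]
    have := norm_integral_le_of_norm_le_const (μ := M.condLaw (fun _ => D) x t (t + (u + T)))
      (f := fun y => (M.condLaw (fun _ => D) y u (u + T)).real B - (endLaw Q 0 u y).real B)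
      (C := rate (c₁ * c₂) k)
      (hS.mono fun y hy => hQ.condLaw_close 0 u hy (n := k) (T := T) le_rfl B hB)
    simpa using this
  rw [add_assoc] at h1
  change |(M.condLaw (fun _ => D) x (t + u) (t + (u + T))).real B - _| ≤ _ at h1
  change |∫ y, (endLaw Q 0 u y).real B ∂(M.condLaw (fun _ => D) x t (t + (u + T))) - _| ≤ _ at h3
  rw [abs_le] at *
  constructor <;> linarith [h1.1, h1.2, h3.1, h3.2, h4.1, h4.2]

/-- By homogeneity a run of length `d + n • t₀` is a restart at time `d` followed by `n` blocks, so
it is close to the run of length `n • t₀` from `x₀`. The laws at multiples of `t₀` are therefore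
Cauchy and attract every starting point. -/
lemma exists_limit_law (h : UniformCV M (fun _ => D) ν t₀ c₁ c₂)
    (hQ : UniformQProcess M (fun _ => D) t₀ (c₁ * c₂) Q) :
    ∃ β : Measure E, IsLawOn β Dᶜ ∧ ∀ x ∈ Dᶜ, ∀ (n : ℕ) t, n • t₀ ≤ t →
      UniformlyClose (endLaw Q 0 t x) β (rate (c₁ * c₂) n) := by
  obtain ⟨x₀, hx₀⟩ := h.nonempty_compl
  have hc := mul_pos h.c₁_pos h.c₂_pos
  have hc' : (0 : ℝ) < (c₁ * c₂ : ℝ≥0) := by exact_mod_cast hc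
  have hc1' : ((c₁ * c₂ : ℝ≥0) : ℝ) ≤ 1 := by exact_mod_cast h.mul_le_one
  have hclose : ∀ x ∈ Dᶜ, ∀ (n : ℕ) t, n • t₀ ≤ t →
      UniformlyClose (endLaw Q 0 t x) (endLaw Q 0 (n • t₀) x₀)
        ((1 - ((c₁ * c₂ : ℝ≥0) : ℝ)) ^ n) := by
    intro x hx n t hn
    obtain ⟨d, rfl⟩ := le_iff_exists_add'.1 hn
    exact h.endLaw_close hQ.const (s := 0) (t := d) hx hx₀ le_rfl
  have hprob : ∀ n : ℕ, IsProbabilityMeasure (endLaw Q 0 (n • t₀) x₀) := fun n =>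
    hQ.isProbabilityMeasure_endLaw 0 _ hx₀
  have hlim : Tendsto (fun n : ℕ => (1 - ((c₁ * c₂ : ℝ≥0) : ℝ)) ^ n) atTop (𝓝 0) :=
    tendsto_pow_atTop_nhds_zero_of_lt_one (by linarith) (by linarith)
  obtain ⟨β, hβ, hβclose⟩ := exists_limit_of_uniformlyClose
    (fun n : ℕ => endLaw Q 0 (n • t₀) x₀) hlim (fun n m hnm => hclose x₀ hx₀ n _ (by
      obtain ⟨k, rfl⟩ := Nat.exists_eq_add_of_le hnm
      rw [add_nsmul t₀ n k]
      exact le_self_add))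
  have hfin : ∀ x ∈ Dᶜ, ∀ (n : ℕ) t, n • t₀ ≤ t →
      UniformlyClose (endLaw Q 0 t x) β (rate (c₁ * c₂) n) := by
    intro x hx n t hn
    refine ((hclose x hx n t hn).trans (hβclose n)).mono ?_
    rw [rate, ← two_mul]
    exact le_div_self (mul_nonneg zero_le_two (pow_nonneg (by linarith) n)) hc' hc1'
  have hD := h.measurable_boundary 0
  refine ⟨β, ⟨hβ, ?_⟩, hfin⟩
  rw [compl_compl]
  have : β.real D = 0 := by
    rw [← abs_nonpos_iff]
    refine le_of_forall_pos_le_add fun ε hε => ?_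
    obtain ⟨k, hk⟩ := exists_rate_lt hc h.mul_le_one (half_pos hε)
    have h1 := hQ.condLaw_close 0 (k • t₀) hx₀ (n := k) (T := (k + 1) • t₀) le_rfl D hD
    have h2 := hfin x₀ hx₀ k (k • t₀) le_rfl D hD
    have h3 := h.condLaw_compl x₀ (le_self_add (a := k • t₀) (b := (k + 1) • t₀))
    rw [compl_compl] at h3
    have h3' : (M.condLaw (shiftBoundary (fun _ => D) 0) x₀ (k • t₀)
      (k • t₀ + (k + 1) • t₀)).real D = 0 := congrArg ENNReal.toReal h3
    rw [h3'] at h1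
    rw [abs_le] at *
    constructor <;> linarith [h1.1, h1.2, h2.1, h2.2]
  rw [measureReal_def, ENNReal.toReal_eq_zero_iff] at this
  exact this.resolve_right (measure_ne_top _ _)

/-- Let `k → ∞` in the semigroup identity at times `k • t₀` and `t`: both sides converge, one to `β`
and the other to `qLaw Q 0 t β`. -/
lemma isInvariantLaw_of_limit (h : UniformCV M (fun _ => D) ν t₀ c₁ c₂)
    (hQ : UniformQProcess M (fun _ => D) t₀ (c₁ * c₂) Q) {β : Measure E} (hβ : IsLawOn β Dᶜ)
    (hlim : ∀ x ∈ Dᶜ, ∀ (n : ℕ) t, n • t₀ ≤ t →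
      UniformlyClose (endLaw Q 0 t x) β (rate (c₁ * c₂) n)) :
    IsInvariantLaw D Q β := by
  refine ⟨hβ, fun t => ?_⟩
  obtain ⟨x₀, hx₀⟩ := h.nonempty_compl
  have := hβ.1
  have := hQ.isFiniteMeasure_qLaw 0 t β
  refine UniformlyClose.eq fun ε hε B hB => ?_
  obtain ⟨k, hk⟩ := exists_rate_lt (mul_pos h.c₁_pos h.c₂_pos) h.mul_le_one (half_pos hε)
  have := hQ.isFiniteMeasure_endLaw 0 (k • t₀) x₀
  have h1 := (hlim x₀ hx₀ k (k • t₀) le_rfl).abs_integral_sub_le_of_unit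
    (hQ.measurable_endLaw_real 0 t hB) (fun y => measureReal_nonneg)
    (fun y => hQ.endLaw_real_le_one 0 t y B)
  have h2 := hlim x₀ hx₀ k (k • t₀ + t) le_self_add B hB
  rw [h.endLaw_add hQ hx₀ (k • t₀) t hB] at h2
  rw [hQ.qLaw_real 0 t β hB]
  rw [abs_le] at *
  constructor <;> linarith [h1.1, h1.2, h2.1, h2.2]

/-- An invariant law equals its own evolution at time `k • t₀`, which is as close to `β` as desired.
-/
lemma eq_of_isInvariantLaw (h : UniformCV M (fun _ => D) ν t₀ c₁ c₂)
    (hQ : UniformQProcess M (fun _ => D) t₀ (c₁ * c₂) Q) {β β' : Measure E} (hβ : IsLawOn β Dᶜ)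
    (hlim : ∀ x ∈ Dᶜ, ∀ (n : ℕ) t, n • t₀ ≤ t →
      UniformlyClose (endLaw Q 0 t x) β (rate (c₁ * c₂) n))
    (hβ' : IsInvariantLaw D Q β') : β' = β := by
  have := hβ.1
  have := hβ'.1.1
  refine UniformlyClose.eq fun ε hε => ?_
  obtain ⟨k, hk⟩ := exists_rate_lt (mul_pos h.c₁_pos h.c₂_pos) h.mul_le_one hε
  rw [← hβ'.2 (k • t₀)]
  exact hQ.qLaw_close hβ'.1 fun x hx => (hlim x hx k _ le_rfl).mono hk.le

end UniformCV

end FixedBoundary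

/-- Shrinking the conditioning event changes conditional probabilities by at most the fraction of
mass lost. This turns convergence of survival probabilities into closeness of conditional laws. -/
lemma cond_uniformlyClose_of_subset {α : Type*} [MeasurableSpace α] {μ : Measure α}
    [IsFiniteMeasure μ] {S S' : Set α} (hS : MeasurableSet S) (hS' : MeasurableSet S')
    (hsub : S' ⊆ S) (hpos : μ S' ≠ 0) :
    UniformlyClose (μ[|S']) (μ[|S]) (1 - μ.real S' / μ.real S) := by
  intro B hB
  have hp' : 0 < μ.real S' := ENNReal.toReal_pos hpos (measure_ne_top _ _)
  have hp : 0 < μ.real S := hp'.trans_le (measureReal_mono hsub)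
  have e1 : (μ[|S']).real B = μ.real (S' ∩ B) / μ.real S' := by
    rw [measureReal_def, cond_apply hS', ENNReal.toReal_mul, ENNReal.toReal_inv, inv_mul_eq_div]
    rfl
  have e2 : (μ[|S]).real B = μ.real (S ∩ B) / μ.real S := by
    rw [measureReal_def, cond_apply hS, ENNReal.toReal_mul, ENNReal.toReal_inv, inv_mul_eq_div]
    rfl
  have h1 : μ.real (S' ∩ B) ≤ μ.real (S ∩ B) :=
    measureReal_mono (Set.inter_subset_inter_left B hsub)
  have h2 : μ.real (S ∩ B) ≤ μ.real (S' ∩ B) + (μ.real S - μ.real S') := by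
    rw [← measureReal_sdiff hsub hS']
    refine (measureReal_mono ?_).trans (measureReal_union_le _ _)
    intro x ⟨hx, hxB⟩
    by_cases hx' : x ∈ S'
    · exact Or.inl ⟨hx', hxB⟩
    · exact Or.inr ⟨hx, hx'⟩
  have h3 : μ.real (S' ∩ B) ≤ μ.real S' := measureReal_mono Set.inter_subset_left
  have h4 : μ.real S' ≤ μ.real S := measureReal_mono hsub
  rw [e1, e2, abs_le]
  constructor
  · have : μ.real (S ∩ B) / μ.real S ≤
        μ.real (S' ∩ B) / μ.real S + (1 - μ.real S' / μ.real S) := by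
      rw [← div_self hp.ne', ← sub_div, ← add_div]
      gcongr
    have : μ.real (S' ∩ B) / μ.real S ≤ μ.real (S' ∩ B) / μ.real S' := by gcongr
    linarith
  · have h5 : μ.real (S' ∩ B) / μ.real S ≤ μ.real (S ∩ B) / μ.real S := by gcongr
    have h6 : μ.real (S' ∩ B) / μ.real S' - μ.real (S' ∩ B) / μ.real S =
        μ.real (S' ∩ B) / μ.real S' * (1 - μ.real S' / μ.real S) := by
      field_simp
    have h7 : μ.real (S' ∩ B) / μ.real S' ≤ 1 := (div_le_one hp').2 h3
    have h8 : 0 ≤ 1 - μ.real S' / μ.real S := sub_nonneg.2 ((div_le_one hp).2 h4)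
    nlinarith

/-! ### Comparison of the late moving boundary with its limit. -/

section Converging

variable {I E Ω : Type*} [AddCommMonoid I] [ConditionallyCompleteLinearOrderBot I]
  [MeasurableSpace I] [MeasurableSpace E] [MeasurableSpace Ω]
  [TopologicalSpace I] [OrderTopology I] [TopologicalSpace E]
  {M : MarkovFamily I E Ω} {A : I → Set E}

namespace ConvergingBoundary

lemma measurableSet_survive (hA : ConvergingBoundary M A) (s t : I) :
    MeasurableSet[M.filtration t] (M.survive (shiftBoundary A s) t) :=
  (hA.stopping s).measurableSet_gt t

lemma measurableSet_survive_limit (hA : ConvergingBoundary M A) (t : I) :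
    MeasurableSet[M.filtration t] (M.survive (fun _ => limitBoundary A) t) :=
  hA.stopping_limit.measurableSet_gt t

lemma exists_uniformCV (hA : ConvergingBoundary M A) :
    ∃ ν t₀ c₁ c₂, UniformCV M A ν t₀ c₁ c₂ := by
  obtain ⟨ν, t₀, c₁, c₂, -, hc₁, hc₂, hν, hmin, hcomp⟩ := hA.moving
  exact ⟨ν, t₀, c₁, c₂, hA.measurable_boundary, hA.measurableSet_survive, hA.survival_pos, hc₁, hc₂,
    hν, hmin, hcomp⟩

lemma measurableSet_limitBoundary [IsCountablyGenerated (atTop : Filter I)]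
    (hA : ConvergingBoundary M A) : MeasurableSet (limitBoundary A) := by
  obtain ⟨u, hu⟩ := exists_seq_tendsto (atTop : Filter I)
  have : limitBoundary A = ⋂ n, A (u n) := by
    refine Set.Subset.antisymm (Set.subset_iInter fun n => Set.iInter_subset A _)
      (Set.subset_iInter fun t => ?_)
    obtain ⟨n, hn⟩ := (hu.eventually (eventually_ge_atTop t)).exists
    exact (Set.iInter_subset _ n).trans (hA.antitone hn)
  rw [this]
  exact MeasurableSet.iInter fun n => hA.measurable_boundary _

lemma exists_uniformCV_limit [IsCountablyGenerated (atTop : Filter I)]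
    (hA : ConvergingBoundary M A) :
    ∃ ν t₀ c₁ c₂, UniformCV M (fun _ => limitBoundary A) (fun _ => ν) t₀ c₁ c₂ := by
  obtain ⟨ν, t₀, c₁, c₂, hc₁, hc₂, hν, hmin, hcomp⟩ := hA.fixed
  refine ⟨ν, t₀, c₁, c₂, fun _ => hA.measurableSet_limitBoundary,
    fun _ t => hA.measurableSet_survive_limit t, fun _ t x hx => ?_, hc₁, hc₂, fun _ => hν,
    fun _ => hmin, fun _ => hcomp⟩
  -- A point outside `A_∞` is outside some `A s`, and surviving `A ∘ θ_s` implies surviving the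
  -- smaller set `A_∞`.
  obtain ⟨s, hs⟩ : ∃ s, x ∉ A s := by simpa [limitBoundary] using hx
  exact (hA.survival_pos s t x hs).trans_le (measure_mono (M.survive_subset_limit A s t))

/-- Inclusion of the survival events gives the upper bound. The lower bound is the portmanteau
argument for `(v, ⊤]`: a continuous test function vanishes up to `v` and equals `1` from `w n` on,
and the mass between is small for large `n`. The sequence `w` treats continuous and discrete time
together. -/
lemma tendsto_survive [SecondCountableTopology I] (hA : ConvergingBoundary M A) {y : E}
    (hy : y ∈ (A 0)ᶜ) {v : I} {w : ℕ → I} (hw : Antitone w) (hvw : ∀ n, v < w n)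
    (hwz : ∀ z, v < z → ∃ n, w n ≤ z) :
    Tendsto (fun r => (M.P y).real (M.survive (shiftBoundary A r) v)) atTop
      (𝓝 ((M.P y).real (M.survive (fun _ => limitBoundary A) v))) := by
  have hτm : Measurable (M.hit fun _ => limitBoundary A) := hA.stopping_limit.measurable'
  have hU : M.survive (fun _ => limitBoundary A) v =
      ⋃ n, {ω | (w n : WithTop I) ≤ M.hit (fun _ => limitBoundary A) ω} := by
    ext ω
    simp only [MarkovFamily.survive, Set.mem_ofPred_eq, Set.mem_iUnion]
    constructor
    · intro h
      induction hz : M.hit (fun _ => limitBoundary A) ω with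
      | top => exact ⟨0, le_top⟩
      | coe z =>
        rw [hz] at h
        obtain ⟨n, hn⟩ := hwz z (WithTop.coe_lt_coe.1 h)
        exact ⟨n, WithTop.coe_le_coe.2 hn⟩
    · rintro ⟨n, hn⟩
      exact (WithTop.coe_lt_coe.2 (hvw n)).trans_le hn
  have hlim : Tendsto (fun n => (M.P y).real
      {ω | (w n : WithTop I) ≤ M.hit (fun _ => limitBoundary A) ω}) atTop
      (𝓝 ((M.P y).real (M.survive (fun _ => limitBoundary A) v))) := by
    rw [hU]
    refine (ENNReal.tendsto_toReal (measure_ne_top _ _)).comp (tendsto_measure_iUnion_atTop ?_)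
    intro a b hab ω hω
    exact (WithTop.coe_le_coe.2 (hw hab)).trans hω
  rw [Metric.tendsto_nhds]
  intro ε hε
  obtain ⟨n, hn⟩ := (hlim.eventually (lt_mem_nhds
    (show (M.P y).real (M.survive (fun _ => limitBoundary A) v) - ε / 2 < _ by linarith))).exists
  have hdisj : Disjoint (Set.Iic (v : WithTop I)) (Set.Ici (w n : WithTop I)) :=
    Set.disjoint_left.2 fun z hz hz' =>
      absurd (hz'.trans hz) (not_le.2 (WithTop.coe_lt_coe.2 (hvw n)))
  obtain ⟨f, hf0, hf1, hf⟩ := exists_bounded_zero_one_of_closed isClosed_Iic isClosed_Ici hdisj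
  have hlow : (M.P y).real {ω | (w n : WithTop I) ≤ M.hit (fun _ => limitBoundary A) ω} ≤
      ∫ ω, f (M.hit (fun _ => limitBoundary A) ω) ∂(M.P y) := by
    have hms : MeasurableSet {ω | (w n : WithTop I) ≤ M.hit (fun _ => limitBoundary A) ω} :=
      hτm measurableSet_Ici
    rw [← integral_indicator_one hms]
    refine integral_mono ((integrable_const (1 : ℝ)).indicator hms) ?_ fun ω => ?_
    · exact Integrable.of_bound (f.continuous.measurable.comp hτm).aestronglyMeasurable 1
        (Eventually.of_forall fun ω => by
          rw [Real.norm_of_nonneg (hf _).1]; exact (hf _).2)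
    · refine Set.indicator_le' (fun ω hω => ?_) (fun ω _ => (hf _).1) ω
      exact (hf1 hω).ge
  filter_upwards [(hA.hit_tendsto y hy f).eventually (lt_mem_nhds
    (show ∫ ω, f (M.hit (fun _ => limitBoundary A) ω) ∂(M.P y) - ε / 2 < _ by linarith))] with r hr
  have hS := M.filtration.le v _ (hA.measurableSet_survive r v)
  have hup : ∫ ω, f (M.hit (shiftBoundary A r) ω) ∂(M.P y) ≤
      (M.P y).real (M.survive (shiftBoundary A r) v) := by
    rw [← integral_indicator_one hS]
    refine integral_mono_of_nonneg (Eventually.of_forall fun ω => (hf _).1)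
      ((integrable_const (1 : ℝ)).indicator hS) (Eventually.of_forall fun ω => ?_)
    by_cases hω : ω ∈ M.survive (shiftBoundary A r) v
    · simpa [hω] using (hf _).2
    · have : f (M.hit (shiftBoundary A r) ω) = 0 := 
        hf0 (show M.hit (shiftBoundary A r) ω ≤ v from not_lt.1 hω)
      simp [hω, this]
  have hle := measureReal_mono (μ := M.P y) (M.survive_subset_limit A r v)
  rw [Real.dist_eq, abs_sub_lt_iff]
  constructor <;> linarith

/-- The conditional laws for the shifted boundaries converge uniformly over measurable sets. -/
lemma eventually_condLaw_close [CanonicallyOrderedAdd I] [SecondCountableTopology I]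
    (hA : ConvergingBoundary M A) {y : E} (hy : y ∈ (A 0)ᶜ) (u : I) {v : I} {w : ℕ → I}
    (hw : Antitone w) (hvw : ∀ n, v < w n) (hwz : ∀ z, v < z → ∃ n, w n ≤ z) {ε : ℝ} (hε : 0 < ε) :
    ∀ᶠ r in atTop, UniformlyClose (M.condLaw (shiftBoundary A r) y u v)
      (M.condLaw (fun _ => limitBoundary A) y u v) ε := by
  have hlim := hA.tendsto_survive hy hw hvw hwz
  set S := M.survive (fun _ => limitBoundary A) v
  have hS : MeasurableSet S := M.filtration.le v _ (hA.measurableSet_survive_limit v)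
  have hpos' : ∀ r, M.P y (M.survive (shiftBoundary A r) v) ≠ 0 := fun r =>
    (hA.survival_pos r v y fun hyr => hy (hA.antitone zero_le hyr)).ne'
  have hpos : (M.P y).real S ≠ 0 :=
    (ENNReal.toReal_pos (fun h0 => hpos' 0 (measure_mono_null (M.survive_subset_limit A 0 v) h0))
      (measure_ne_top _ _)).ne'
  have hdiff : Tendsto (fun r => 1 - (M.P y).real (M.survive (shiftBoundary A r) v) /
      (M.P y).real S) atTop (𝓝 0) := by
    have := (hlim.div_const ((M.P y).real S)).const_sub 1
    rwa [div_self hpos, sub_self] at this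
  filter_upwards [hdiff.eventually (gt_mem_nhds hε)] with r hr
  exact ((cond_uniformlyClose_of_subset hS (M.filtration.le v _ (hA.measurableSet_survive r v))
    (M.survive_subset_limit A r v) (hpos' r)).map (M.measurable_X u)).mono hr.le

end ConvergingBoundary

end Converging

/-! ### Convergence of the moving `Q`-process to `β`. -/

section Limit

variable {I E Ω : Type*} [AddCommMonoid I] [ConditionallyCompleteLinearOrderBot I]
  [MeasurableSpace I] [MeasurableSpace E] [MeasurableSpace Ω]
  [TopologicalSpace I] [OrderTopology I] [SecondCountableTopology I] [TopologicalSpace E]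
  [IsOrderedCancelAddMonoid I] [CanonicallyOrderedAdd I]
  {M : MarkovFamily I E Ω} {A : I → Set E}

namespace ConvergingBoundary

/-- The point `y` of `E_0` lies in every `E_s`, so it is an admissible restart at any late time. The
threshold depends on neither `s` nor `x`, because only the forgetting step involves them and the
late restart time is at least `r₀`. -/
lemma exists_forall_endLaw_close (hA : ConvergingBoundary M A)
    (hI : ∀ v : I, ∃ w : ℕ → I, Antitone w ∧ (∀ n, v < w n) ∧ ∀ z, v < z → ∃ n, w n ≤ z)
    {ν : I → Measure E} {t₀ : I} {c₁ c₂ : ℝ≥0} (h : UniformCV M A ν t₀ c₁ c₂)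
    {ν' : I → Measure E} {t₀' : I} {c₁' c₂' : ℝ≥0}
    (h' : UniformCV M (fun _ => limitBoundary A) ν' t₀' c₁' c₂')
    {Q Q' : (s t : I) → E → Measure (Set.Iic t → E)}
    (hQ : UniformQProcess M A t₀ (c₁ * c₂) Q)
    (hQ' : UniformQProcess M (fun _ => limitBoundary A) t₀' (c₁' * c₂') Q')
    {β : Measure E} (hβ : ∀ x ∈ (limitBoundary A)ᶜ, ∀ (n : ℕ) t, n • t₀' ≤ t →
      UniformlyClose (endLaw Q' 0 t x) β (rate (c₁' * c₂') n)) {ε : ℝ} (hε : 0 < ε) :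
    ∃ N, ∀ s t, N ≤ t → ∀ x ∈ (A s)ᶜ, UniformlyClose (endLaw Q s t x) β ε := by
  have hε5 : 0 < ε / 5 := by positivity
  have hc := mul_pos h.c₁_pos h.c₂_pos
  obtain ⟨n, hn⟩ := exists_rate_lt hc h.mul_le_one hε5
  obtain ⟨n', hn'⟩ := exists_rate_lt (mul_pos h'.c₁_pos h'.c₂_pos) h'.mul_le_one hε5
  obtain ⟨y, hy⟩ := h.nonempty_compl
  have hyA : ∀ s, y ∈ (A s)ᶜ := fun s hys => hy (hA.antitone zero_le hys)
  have hylim : y ∈ (limitBoundary A)ᶜ := fun hyl => hy (Set.mem_iInter.1 hyl 0)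
  set u := n • t₀ + n' • t₀' with hu
  set T := (n + 1) • t₀ + (n' + 1) • t₀' with hT
  obtain ⟨w, hw, hvw, hwz⟩ := hI (u + T)
  obtain ⟨r₀, hr₀⟩ := eventually_atTop.1 (hA.eventually_condLaw_close hy u hw hvw hwz hε5)
  refine ⟨r₀ + u, fun s t ht x hx => ?_⟩
  obtain ⟨d, rfl⟩ := le_iff_exists_add.1 ht
  -- The elapsed time is split as `(r₀ + d) + u`. Five errors follow: restart from `y` at time `s +
  -- (r₀ + d)`, finite horizon `T`, boundary `A_∞`, infinite horizon, long-time limit.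
  rw [add_right_comm]
  have e1 := (h.endLaw_close hQ hx (hyA (s + (r₀ + d))) (n := n) (u := u) le_self_add).mono
    ((pow_le_rate hc h.mul_le_one n).trans hn.le)
  have e2 := (hQ.condLaw_close (s + (r₀ + d)) u (hyA _) (n := n) (T := T) le_self_add).mono hn.le
  have e3 := hr₀ (s + (r₀ + d)) (le_self_add.trans le_add_self)
  have e4 := (hQ'.condLaw_close 0 u hylim (n := n') (T := T) le_add_self).mono hn'.le
  have e5 := (hβ y hylim n' u le_add_self).mono hn'.le
  exact ((((e1.trans e2.symm).trans e3).trans e4).trans e5).mono (by linarith)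

/-- The conclusions common to discrete and continuous time. -/
theorem exists_qProcesses [IsCountablyGenerated (atTop : Filter I)] [OpensMeasurableSpace E]
    (hA : ConvergingBoundary M A)
    (hI : ∀ v : I, ∃ w : ℕ → I, Antitone w ∧ (∀ n, v < w n) ∧ ∀ z, v < z → ∃ n, w n ≤ z) :
    ∃ (Qinf Q : (s t : I) → E → Measure (Set.Iic t → E)) (β : Measure E),
      IsQProcess M (fun _ => limitBoundary A) Qinf ∧
      IsInvariantLaw (limitBoundary A) Qinf β ∧
      (∀ β', IsInvariantLaw (limitBoundary A) Qinf β' → β' = β) ∧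
      (∀ x ∈ (A 0)ᶜ, ∀ ε > 0, ∃ N, ∀ v w, N ≤ v → v + N ≤ w →
        UniformlyClose (M.condLaw A x v w) β ε) ∧
      IsQProcess M A Q ∧
      ∀ s, ∀ μ, IsLawOn μ (A s)ᶜ → ConvergesInLaw (fun t => qLaw Q s t μ) β := by
  obtain ⟨ν, t₀, c₁, c₂, h⟩ := hA.exists_uniformCV
  obtain ⟨ν', t₀', c₁', c₂', h'⟩ := hA.exists_uniformCV_limit
  obtain ⟨Q, hQ⟩ := h.exists_measurable_version
  obtain ⟨Q', hQ'⟩ := h'.exists_measurable_version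
  obtain ⟨β, hβlaw, hβ⟩ := h'.exists_limit_law hQ'
  have hc := mul_pos h.c₁_pos h.c₂_pos
  have key : ∀ ε > 0, ∃ N, ∀ s t, N ≤ t → ∀ x ∈ (A s)ᶜ, UniformlyClose (endLaw Q s t x) β ε :=
    fun ε hε => hA.exists_forall_endLaw_close hI h h' hQ hQ' hβ hε
  refine ⟨Q', Q, β, hQ'.isQProcess (mul_pos h'.c₁_pos h'.c₂_pos) h'.mul_le_one,
    h'.isInvariantLaw_of_limit hQ' hβlaw hβ, fun β' => h'.eq_of_isInvariantLaw hQ' hβlaw hβ,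
    fun x hx ε hε => ?_, hQ.isQProcess hc h.mul_le_one, fun s μ hμ => ?_⟩
  · obtain ⟨N, hN⟩ := key (ε / 2) (half_pos hε)
    obtain ⟨n, hn⟩ := exists_rate_lt hc h.mul_le_one (half_pos hε)
    -- One margin is used twice: `v` is large enough for the `Q`-process to be near `β`, and `w - v`
    -- is large enough for the conditional law to be near the `Q`-process.
    refine ⟨N + (n + 1) • t₀, fun v w hv hw => ?_⟩
    obtain ⟨T, rfl⟩ := le_iff_exists_add.1 (le_self_add.trans hw)
    have hT : (n + 1) • t₀ ≤ T := le_add_self.trans (le_of_add_le_add_left hw)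
    have e1 := hQ.condLaw_close 0 v hx hT
    rw [shiftBoundary_zero] at e1
    exact (e1.trans (hN 0 v (le_self_add.trans hv) x hx)).mono (by linarith)
  · have := hβlaw.1
    have := hμ.1
    refine ConvergesInLaw.of_uniformlyClose fun ε hε => ?_
    obtain ⟨N, hN⟩ := key ε hε
    filter_upwards [eventually_ge_atTop N] with t ht
    exact ⟨hQ.isFiniteMeasure_qLaw s t μ, hQ.qLaw_close hμ (hN s t ht)⟩

end ConvergingBoundary

end Limit

/-! ### Time averages of the conditional laws. -/

section Averages

variable {E Ω : Type*} [MeasurableSpace E] [MeasurableSpace Ω]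

lemma abs_measureReal_sub_le_one {α : Type*} [MeasurableSpace α] (μ β : Measure α)
    [IsProbabilityMeasure μ] [IsProbabilityMeasure β] (B : Set α) :
    |μ.real B - β.real B| ≤ 1 := by
  rw [abs_le]
  constructor <;> linarith [measureReal_le_one (μ := μ) (s := B),
    measureReal_le_one (μ := β) (s := B), measureReal_nonneg (μ := μ) (s := B),
    measureReal_nonneg (μ := β) (s := B)]

/-- At most `N` early and `N` late terms are bad, each costing at most `1`. The `n + 1` terms are
divided by `n`: the excess mass adds the last `1 / n`, and `(n + 1) / n ≤ 2` doubles `ε`. -/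
lemma discreteTimeAverage_close {M : MarkovFamily ℕ E Ω} {A : ℕ → Set E} {x : E}
    (hprob : ∀ k n, IsProbabilityMeasure (M.condLaw A x k n)) {β : Measure E}
    [IsProbabilityMeasure β] {ε : ℝ} {N : ℕ}
    (hN : ∀ v w, N ≤ v → v + N ≤ w → UniformlyClose (M.condLaw A x v w) β ε) {n : ℕ} (hn : 0 < n)
    (hε : 0 ≤ ε) :
    UniformlyClose (discreteTimeAverage M A x n) β (2 * ε + (2 * N + 1) / n) := by
  intro B hB
  have hn' : (0 : ℝ) < n := by exact_mod_cast hn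
  have hn1 : (1 : ℝ) ≤ n := by exact_mod_cast hn
  have e1 : (discreteTimeAverage M A x n).real B =
      (n : ℝ)⁻¹ * ∑ k ∈ Finset.range (n + 1), (M.condLaw A x k n).real B := by
    rw [discreteTimeAverage, measureReal_def, Measure.smul_apply, Measure.finsetSum_apply,
      ENNReal.smul_def, smul_eq_mul, ENNReal.toReal_mul,
      ENNReal.toReal_sum fun k _ => measure_ne_top _ _]
    simp [measureReal_def]
  have hterm : ∀ k ∈ Finset.range (n + 1), |(M.condLaw A x k n).real B - β.real B| ≤
      ε + (if k < N then 1 else 0) + (if n < k + N then 1 else 0) := by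
    intro k _
    have := hprob k n
    have h1 := abs_measureReal_sub_le_one (M.condLaw A x k n) β B
    split_ifs with hk hk' hk'
    · linarith
    · linarith
    · linarith
    · simpa using hN k n (not_lt.1 hk) (not_lt.1 hk') B hB
  have hs1 : ∑ k ∈ Finset.range (n + 1), (if k < N then (1 : ℝ) else 0) ≤ N := by
    rw [Finset.sum_boole]
    have : (Finset.range (n + 1)).filter (· < N) ⊆ Finset.range N := fun k hk => by
      simpa using (Finset.mem_filter.1 hk).2
    exact_mod_cast (Finset.card_le_card this).trans (Finset.card_range N).le
  have hs2 : ∑ k ∈ Finset.range (n + 1), (if n < k + N then (1 : ℝ) else 0) ≤ N := by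
    rw [Finset.sum_boole]
    have : (Finset.range (n + 1)).filter (fun k => n < k + N) ⊆
        Finset.Ico (n + 1 - N) (n + 1) :=
      fun k hk => by
        simp only [Finset.mem_filter, Finset.mem_range, Finset.mem_Ico] at hk ⊢
        omega
    have hcard := Finset.card_le_card this
    rw [Nat.card_Ico] at hcard
    exact_mod_cast hcard.trans (by omega)
  have hsum := (Finset.abs_sum_le_sum_abs _ _).trans (Finset.sum_le_sum hterm)
  rw [Finset.sum_add_distrib, Finset.sum_add_distrib, Finset.sum_sub_distrib, Finset.sum_const,
    Finset.sum_const, Finset.card_range, nsmul_eq_mul, nsmul_eq_mul] at hsum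
  push_cast at hsum
  have hb0 : 0 ≤ β.real B := measureReal_nonneg
  have hb1 : β.real B ≤ 1 := measureReal_le_one
  set total := ∑ k ∈ Finset.range (n + 1), (M.condLaw A x k n).real B
  have e2 : (n : ℝ)⁻¹ * total - β.real B = (total - (n + 1) * β.real B + β.real B) / n := by
    field_simp
    ring
  have e3 : 2 * ε + (2 * N + 1) / (n : ℝ) = (2 * ε * n + (2 * N + 1)) / n := by
    field_simp
  rw [e1, e2, e3, abs_div, abs_of_pos hn']
  gcongr
  refine (abs_add_le _ _).trans ?_
  rw [abs_of_nonneg hb0]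
  nlinarith

lemma measurable_condLaw_time {M : MarkovFamily ℝ≥0 E Ω} {A : ℝ≥0 → Set E} (x : E) (t : ℝ≥0) :
    Measurable fun s : ℝ≥0 => M.condLaw A x s t := by
  refine Measure.measurable_of_measurable_coe _ fun B hB => ?_
  have : (fun s : ℝ≥0 => M.condLaw A x s t B) =
      fun s => M.condP A x t (Prod.mk s ⁻¹' (Function.uncurry M.X ⁻¹' B)) := by
    funext s
    rw [MarkovFamily.condLaw, Measure.map_apply (M.measurable_X s) hB]
    rfl
  rw [this]
  exact measurable_measure_prodMk_left (M.measurable_uncurry_X hB)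

/-- Times within `N` of either end of `(0, t]` contribute at most `2 * N`, each costing at most `1`
per unit of time; all others are within `ε`. -/
lemma timeAverage_close {M : MarkovFamily ℝ≥0 E Ω} {A : ℝ≥0 → Set E} {x : E}
    (hprob : ∀ s t, IsProbabilityMeasure (M.condLaw A x s t)) {β : Measure E}
    [IsProbabilityMeasure β] {ε : ℝ} {N : ℝ≥0}
    (hN : ∀ v w, N ≤ v → v + N ≤ w → UniformlyClose (M.condLaw A x v w) β ε) {t : ℝ≥0}
    (ht : 0 < t) :
    IsFiniteMeasure (timeAverage M A x t) ∧
      UniformlyClose (timeAverage M A x t) β (ε + 2 * N / t) := by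
  have ht' : (0 : ℝ) < t := by exact_mod_cast ht
  set vol := (volume : Measure ℝ).restrict (Set.Ioc 0 (t : ℝ)) with hvol
  have hvfin : IsFiniteMeasure vol := ⟨by simp [hvol]⟩
  have hm : Measurable fun s : ℝ => M.condLaw A x s.toNNReal t :=
    (measurable_condLaw_time x t).comp measurable_real_toNNReal
  have hreal : ∀ B, MeasurableSet B → Measurable fun s : ℝ => (M.condLaw A x s.toNNReal t).real B :=
    fun B hB => ((Measure.measurable_coe hB).comp hm).ennreal_toReal
  have hint : ∀ B, MeasurableSet B →
      Integrable (fun s : ℝ => (M.condLaw A x s.toNNReal t).real B) vol := fun B hB =>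
    Integrable.of_bound (hreal B hB).aestronglyMeasurable 1 (Eventually.of_forall fun s => by
      have := hprob s.toNNReal t
      rw [Real.norm_of_nonneg measureReal_nonneg]
      exact measureReal_le_one)
  have hbind : IsFiniteMeasure (vol.bind fun s => M.condLaw A x s.toNNReal t) := ⟨by
    rw [Measure.bind_apply MeasurableSet.univ hm.aemeasurable]
    have : ∀ s : ℝ, M.condLaw A x s.toNNReal t Set.univ = 1 := fun s =>
      (hprob s.toNNReal t).measure_univ
    simp [this, measure_lt_top]⟩
  refine ⟨inferInstanceAs (IsFiniteMeasure (t⁻¹ • vol.bind fun s => M.condLaw A x s.toNNReal t)),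
    fun B hB => ?_⟩
  have e1 : (timeAverage M A x t).real B =
      (t : ℝ)⁻¹ * ∫ s, (M.condLaw A x s.toNNReal t).real B ∂vol := by
    rw [timeAverage, measureReal_def, Measure.smul_apply, ENNReal.smul_def, smul_eq_mul,
      ENNReal.toReal_mul, Measure.bind_apply hB hm.aemeasurable]
    congr 1
    exact (integral_toReal ((Measure.measurable_coe hB).comp hm).aemeasurable
      (Eventually.of_forall fun _ => measure_lt_top _ _)).symm
  have hvreal : vol.real Set.univ = t := by simp [hvol, measureReal_def]
  have hi1 : Integrable ((Set.Iio (N : ℝ)).indicator (1 : ℝ → ℝ)) vol :=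
    (integrable_const (1 : ℝ)).indicator measurableSet_Iio
  have hi2 : Integrable ((Set.Ioi ((t : ℝ) - N)).indicator (1 : ℝ → ℝ)) vol :=
    (integrable_const (1 : ℝ)).indicator measurableSet_Ioi
  have hterm : ∀ᵐ s ∂vol, ‖(M.condLaw A x s.toNNReal t).real B - β.real B‖ ≤
      ε + (Set.Iio (N : ℝ)).indicator 1 s + (Set.Ioi ((t : ℝ) - N)).indicator 1 s := by
    filter_upwards [ae_restrict_mem measurableSet_Ioc] with s hs
    have := hprob s.toNNReal t
    have h1 := abs_measureReal_sub_le_one (M.condLaw A x s.toNNReal t) β B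
    have hε0 : 0 ≤ ε := (abs_nonneg _).trans
      (hN N (N + N) le_rfl le_rfl B hB)
    rw [Real.norm_eq_abs]
    by_cases hsN : s < N
    · have h2 : 0 ≤ (Set.Ioi ((t : ℝ) - N)).indicator (1 : ℝ → ℝ) s :=
        Set.indicator_nonneg (by simp) s
      rw [Set.indicator_of_mem (show s ∈ Set.Iio (N : ℝ) from hsN), Pi.one_apply]
      linarith
    · rw [Set.indicator_of_notMem (show s ∉ Set.Iio (N : ℝ) from hsN)]
      by_cases hst : (t : ℝ) - N < s
      · rw [Set.indicator_of_mem (show s ∈ Set.Ioi ((t : ℝ) - N) from hst), Pi.one_apply]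
        linarith
      · rw [Set.indicator_of_notMem (show s ∉ Set.Ioi ((t : ℝ) - N) from hst), add_zero, add_zero]
        have hcoe := Real.coe_toNNReal s hs.1.le
        refine hN _ _ ?_ ?_ B hB
        · rw [← NNReal.coe_le_coe, hcoe]; exact not_lt.1 hsN
        · rw [← NNReal.coe_le_coe, NNReal.coe_add, hcoe]; linarith [not_lt.1 hst]
  have hb1 : vol.real (Set.Iio (N : ℝ)) ≤ N := by
    have : Set.Iio (N : ℝ) ∩ Set.Ioc 0 (t : ℝ) ⊆ Set.Ico 0 (N : ℝ) := fun s hs =>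
      ⟨hs.2.1.le, hs.1⟩
    rw [hvol, measureReal_restrict_apply measurableSet_Iio]
    refine (measureReal_mono this (by simp)).trans ?_
    simp
  have hb2 : vol.real (Set.Ioi ((t : ℝ) - N)) ≤ N := by
    have : Set.Ioi ((t : ℝ) - N) ∩ Set.Ioc 0 (t : ℝ) ⊆ Set.Ioc ((t : ℝ) - N) t := fun s hs =>
      ⟨hs.1, hs.2.2⟩
    rw [hvol, measureReal_restrict_apply measurableSet_Ioi]
    refine (measureReal_mono this (by simp)).trans ?_
    simp
  have hi12 : Integrable (fun s => ε + (Set.Iio (N : ℝ)).indicator (1 : ℝ → ℝ) s) vol :=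
    (integrable_const ε).add hi1
  have hbound := norm_integral_le_of_norm_le (hi12.add hi2) hterm
  rw [integral_sub (hint B hB) (integrable_const _), integral_add' hi12 hi2,
    integral_add (integrable_const ε) hi1,
    integral_indicator_one measurableSet_Iio, integral_indicator_one measurableSet_Ioi,
    integral_const, integral_const, hvreal, smul_eq_mul, smul_eq_mul, Real.norm_eq_abs] at hbound
  have e2 : (t : ℝ)⁻¹ * ∫ s, (M.condLaw A x s.toNNReal t).real B ∂vol - β.real B =
      (∫ s, (M.condLaw A x s.toNNReal t).real B ∂vol - t * β.real B) / t := by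
    field_simp
  have e3 : ε + 2 * N / (t : ℝ) = (t * ε + 2 * N) / t := by
    field_simp
  rw [e1, e2, e3, abs_div, abs_of_pos ht']
  gcongr
  linarith

end Averages

end MovingBoundary

/-! ### Assembly for the two time sets. -/

theorem mainTheorem4 {E Ω : Type*} [TopologicalSpace E] [MeasurableSpace E]
    [OpensMeasurableSpace E] [MeasurableSpace Ω] :
    -- continuous time
    (∀ (M : MovingBoundary.MarkovFamily ℝ≥0 E Ω) (A : ℝ≥0 → Set E),
      MovingBoundary.ConvergingBoundary M A →
      ∃ (Qinf Q : (s t : ℝ≥0) → E → Measure (Set.Iic t → E)) (β : Measure E),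
        MovingBoundary.IsQProcess M (fun _ => MovingBoundary.limitBoundary A) Qinf ∧
        MovingBoundary.IsInvariantLaw (MovingBoundary.limitBoundary A) Qinf β ∧
        (∀ β', MovingBoundary.IsInvariantLaw (MovingBoundary.limitBoundary A) Qinf β' → β' = β) ∧
        (∀ x ∈ (A 0)ᶜ, MovingBoundary.ConvergesInLaw (MovingBoundary.timeAverage M A x) β) ∧
        MovingBoundary.IsQProcess M A Q ∧
        ∀ s, ∀ μ, MovingBoundary.IsLawOn μ (A s)ᶜ →
          MovingBoundary.ConvergesInLaw (fun t => MovingBoundary.qLaw Q s t μ) β) ∧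
    -- discrete time
    (∀ (M : MovingBoundary.MarkovFamily ℕ E Ω) (A : ℕ → Set E),
      MovingBoundary.ConvergingBoundary M A →
      ∃ (Qinf Q : (s t : ℕ) → E → Measure (Set.Iic t → E)) (β : Measure E),
        MovingBoundary.IsQProcess M (fun _ => MovingBoundary.limitBoundary A) Qinf ∧
        MovingBoundary.IsInvariantLaw (MovingBoundary.limitBoundary A) Qinf β ∧
        (∀ β', MovingBoundary.IsInvariantLaw (MovingBoundary.limitBoundary A) Qinf β' → β' = β) ∧
        (∀ x ∈ (A 0)ᶜ,
          MovingBoundary.ConvergesInLaw (MovingBoundary.discreteTimeAverage M A x) β) ∧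
        MovingBoundary.IsQProcess M A Q ∧
        ∀ s, ∀ μ, MovingBoundary.IsLawOn μ (A s)ᶜ →
          MovingBoundary.ConvergesInLaw (fun t => MovingBoundary.qLaw Q s t μ) β) := by
  refine ⟨fun M A hA => ?_, fun M A hA => ?_⟩
  · obtain ⟨Qinf, Q, β, h1, h2, h3, h4, h5, h6⟩ := hA.exists_qProcesses fun v =>
      -- In continuous time the sequence decreases strictly to `v`; in discrete time the constant `v
      -- + 1`, the next instant, suffices.
      ⟨fun n => v + 1 / ((n : NNReal) + 1), fun a b hab => by dsimp only; gcongr,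
        fun n => lt_add_of_pos_right v (by positivity), fun z hz => by
          obtain ⟨n, hn⟩ := exists_nat_one_div_lt (tsub_pos_of_lt hz)
          exact ⟨n, (add_le_add_right hn.le v).trans (add_tsub_cancel_of_le hz.le).le⟩⟩
    refine ⟨Qinf, Q, β, h1, h2, h3, fun x hx => ?_, h5, h6⟩
    have := h2.1.1
    obtain ⟨ν, t₀, c₁, c₂, h⟩ := hA.exists_uniformCV
    refine MovingBoundary.ConvergesInLaw.of_uniformlyClose fun ε hε => ?_
    obtain ⟨N, hN⟩ := h4 x hx (ε / 2) (half_pos hε)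
    filter_upwards [eventually_gt_atTop 0, eventually_ge_atTop (4 * N / ε.toNNReal)] with t ht htN
    have hclose := MovingBoundary.timeAverage_close
      (fun s t => h.isProbabilityMeasure_condLaw hx s t) hN ht
    refine ⟨hclose.1, hclose.2.mono ?_⟩
    rw [div_le_iff₀ (Real.toNNReal_pos.2 hε), ← NNReal.coe_le_coe] at htN
    push_cast at htN
    rw [Real.coe_toNNReal _ hε.le] at htN
    have : 2 * (N : ℝ) / t ≤ ε / 2 := by
      rw [div_le_iff₀ (by exact_mod_cast ht)]
      linarith
    linarith
  · obtain ⟨Qinf, Q, β, h1, h2, h3, h4, h5, h6⟩ := hA.exists_qProcesses fun v =>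
      ⟨fun _ => v + 1, fun _ _ _ => le_rfl, fun _ => Nat.lt_succ_self v, fun z hz => ⟨0, hz⟩⟩
    refine ⟨Qinf, Q, β, h1, h2, h3, fun x hx => ?_, h5, h6⟩
    have := h2.1.1
    obtain ⟨ν, t₀, c₁, c₂, h⟩ := hA.exists_uniformCV
    refine MovingBoundary.ConvergesInLaw.of_uniformlyClose fun ε hε => ?_
    -- The quarter compensates the factor `2` in `discreteTimeAverage_close`; `n₀` keeps the
    -- boundary terms below `ε / 2`.
    obtain ⟨N, hN⟩ := h4 x hx (ε / 4) (by positivity)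
    obtain ⟨n₀, hn₀⟩ := exists_nat_gt ((2 * (2 * N + 1)) / ε)
    filter_upwards [eventually_gt_atTop 0, eventually_ge_atTop n₀] with n hn hnn₀
    have hclose := MovingBoundary.discreteTimeAverage_close
      (fun s t => h.isProbabilityMeasure_condLaw hx s t) hN hn
      (by positivity)
    refine ⟨?_, hclose.mono ?_⟩
    · exact inferInstanceAs (IsFiniteMeasure ((n : NNReal)⁻¹ •
        ∑ k ∈ Finset.range (n + 1), M.condLaw A x k n))
    · have hn' : (0 : ℝ) < n := by exact_mod_cast hn
      have : (n₀ : ℝ) ≤ n := by exact_mod_cast hnn₀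
      have h7 := (div_lt_iff₀ hε).1 (hn₀.trans_le this)
      have : (2 * (N : ℝ) + 1) / n ≤ ε / 2 := by
        rw [div_le_iff₀ hn']
        linarith
      linarith
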